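/- Consider the synchronous message-passing model on a graph, with sleeping. In each round every node is awake or asleep. An awake node may send one message to each of its neighbours, receives the messages sent to it in this round by awake neighbours, performs arbitrary local computation, and then either terminates or fixes the number of rounds for which it sleeps next. A sleeping node does nothing, cannot be woken up, and the messages sent to it are lost. All nodes are awake in the first round. Initially a node knows a global parameter $n$, its own identifier, the identifiers of its neighbours, and which of its neighbours lie in its own cluster. For all constants $a, b \in \mathbb{N}$ and $C_0, C_1, C_2 \in \mathbb{R}$ there are a constant $K$ and a deterministic distributed algorithm such that the following holds for every integer $n \ge 3$. Let $G$ be a connected graph with at most $C_0 (\log n)^a$ nodes that carry distinct identifiers from $\{0, \dots, n^b - 1\}$, and let the nodes of $G$ be partitioned into at most $C_1 \frac{\log n}{\log\log n}$ clusters, each of which induces a connected subgraph of $G$ of diameter at most $C_2 \log\log n$. Then, run on $G$, 1. the algorithm uses messages of at most $K \log n$ bits (i.e. it works in the $\mathsf{CONGEST}$ model); 2. all nodes terminate within $K \log n \cdot (\log\log n)^2$ rounds; 3. each node is awake in at most $K \log\log n$ rounds; and 4. at the end the algorithm has found a spanning tree $T$ of $G$ of diameter at most $K \log n$: each node outputs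 the set of the identifiers of its neighbours in $T$. In particular, the algorithm always succeeds, hence with probability at least $1 - n^{-10}$. -/

import Mathlib

/-- An input graph: a graph on `V` with distinct node identifiers and a clustering of its nodes,
the clusters being the classes of an equivalence relation. -/
structure ClusteredNetwork (V : Type) where
  /-- the communication graph, which is also the input graph -/
  graph : SimpleGraph V
  /-- the identifiers of the nodes -/
  ident : V ↪ ℕ
  /-- the partition of the nodes into clusters -/
  cluster : Setoid V

/-- What a node knows at the start: its identifier, the identifiers of its neighbours, and which
of its neighbours belong to its own cluster. -/
structure LocalView where
  /-- the identifier of the node -/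
  ident : ℕ
  /-- the identifiers of the neighbours of the node -/
  nbrs : Set ℕ
  /-- the identifiers of the neighbours that lie in the cluster of the node -/
  clusterNbrs : Set ℕ

/-- The initial knowledge of the node `v`. -/
def ClusteredNetwork.view {V : Type} (N : ClusteredNetwork V) (v : V) : LocalView where
  ident := N.ident v
  nbrs := {i | ∃ u, N.graph.Adj v u ∧ N.ident u = i}
  clusterNbrs := {i | ∃ u, N.graph.Adj v u ∧ N.cluster v u ∧ N.ident u = i}

/-- A deterministic distributed algorithm in the synchronous message-passing model with sleeping.
All nodes run the same algorithm. Local computation is unrestricted, and messages are bit strings.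
In every round in which it is awake, a node sends at most one message to each neighbour, receives
the messages sent to it in this round, updates its state, and then decides for how many rounds it
sleeps, or terminates. -/
structure SleepingAlgorithm where
  /-- local states of a node -/
  State : Type
  /-- the initial state, computed from the global parameter `n` and the initial knowledge -/
  init : ℕ → LocalView → State
  /-- the message (if any) sent by a node to the neighbour with the given identifier -/
  send : State → ℕ → Option (List Bool)
  /-- the new state, computed from the old one and the set of all pairs (identifier of the
  sender, message) received in the round -/
  step : State → Set (ℕ × List Bool) → State
  /-- evaluated at the new state: `some k` to sleep for the next `k` rounds and be awake in the
  round after them, `none` to terminate -/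
  sleep : State → Option ℕ
  /-- the output of a node, a set of identifiers of neighbours -/
  output : State → Set ℕ

namespace SleepingAlgorithm

variable (A : SleepingAlgorithm) {V : Type} (N : ClusteredNetwork V) (n : ℕ)

open Classical in
/-- `A.run N n t v` is the situation of the node `v` just before round `t` (rounds are numbered
from `0`): its state, and the number of the next round in which it is awake (`none` if it has
terminated). All nodes are awake in round `0`. A sleeping node does nothing, and messages sent to
it are lost. -/
noncomputable def run : ℕ → V → A.State × Option ℕ
  | 0, v => (A.init n (N.view v), some 0)
  | t + 1, v =>
    if (run t v).2 = some t then
      let s := A.step (run t v).1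
        {p | ∃ u, N.graph.Adj v u ∧ (run t u).2 = some t ∧ N.ident u = p.1 ∧
          A.send (run t u).1 (N.ident v) = some p.2}
      (s, (A.sleep s).map (fun k => t + 1 + k))
    else run t v

/-- The node `v` is awake in round `t`. -/
def Awake (t : ℕ) (v : V) : Prop := (A.run N n t v).2 = some t

/-- The node `v` terminates within the first `R` rounds, i.e. the rounds `0, …, R - 1`. -/
def TerminatesWithin (R : ℕ) (v : V) : Prop := (A.run N n R v).2 = none

/-- The number of rounds among the first `R` ones in which the node `v` is awake. -/
noncomputable def awakeRounds (R : ℕ) (v : V) : ℕ := {t | t < R ∧ A.Awake N n t v}.ncard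

/-- Every message sent to a neighbour in any round consists of at most `B` bits. -/
def MessagesBoundedBy (B : ℝ) : Prop :=
  ∀ (t : ℕ) (v u : V), A.Awake N n t v → N.graph.Adj v u →
    ∀ m, A.send (A.run N n t v).1 (N.ident u) = some m → (m.length : ℝ) ≤ B

/-- After `R` rounds the outputs of the nodes describe the graph `T` on the same nodes: every node
outputs exactly the set of the identifiers of its neighbours in `T`. -/
def Outputs (R : ℕ) (T : SimpleGraph V) : Prop :=
  ∀ v, A.output (A.run N n R v).1 = {i | ∃ u, T.Adj v u ∧ N.ident u = i}

end SleepingAlgorithm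

/-! The algorithm merges trees in the manner of Borůvka, in `O(log log n)` stages, and each node is
awake in five rounds of a stage.

Stages. Let the nodes form rooted trees, with labels between `1` and `H` that increase from parent
to child. The labels can serve as a timetable: a child reports in the one round in which its parent
listens, and listens in the one round in which its parent tells. So one exchange with all
neighbours, one aggregation to the roots and one broadcast from them take `2 * H + 3` rounds, five
of them awake (`exists_transition`, `execution`). The labels need not be depths, which is what makes
merging cheap.

Merging. Flooding the minimal identifier and growing a tree from its owner spans every cluster.
Then, in each phase, every tree picks any edge that leaves it and is rerooted at its endpoint of
this edge. Two Cole–Vishkin steps, starting from the root identifiers, colour the trees with `O(log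
log n)` colours such that each picked edge joins different colours. A tree attaches along its edge
if the colour at the other end is smaller, or if it is larger and no tree of larger colour has
picked an edge into the tree itself. A tree that does not attach has therefore been picked by a tree
of larger colour, which does attach to it, and the number of trees is halved
(`two_mul_ncard_rootSet_le`). Hence `O(log log n)` phases suffice. There are no cycles, because
colours yield time slots that increase from a tree to those attached to it (`slotOf_lt`). The label
`slot * depth + old label` is then a valid timetable for one more broadcast, which recomputes depths
and root identifiers.

Depth. Tree edges are never removed, only reversed, so nodes of one cluster stay joined by a tree
path of length at most `2 * D`, where `D` bounds the cluster diameters. Along a path from a root,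
nodes at spacing `2 * D + 1` lie in different clusters. With at most `M` clusters every tree has
depth at most `M * (2 * D + 1) = O(log n)`, whatever the history of the merges
(`IsForest.label_le`).

Cost. Labels are at most `O(log log n)` slots times depth `O(log n)`. Multiplied by `O(log log n)`
stages this gives the number of rounds. A message is a bounded number of numbers of `O(log n)` bits.
-/

/-! ### Runs of a sleeping algorithm -/

namespace SleepingAlgorithm

variable (A : SleepingAlgorithm) {V : Type} (N : ClusteredNetwork V) (n : ℕ)

/-- The messages that reach `v` in round `t` if `v` is awake. -/
def inbox (t : ℕ) (v : V) : Set (ℕ × List Bool) :=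
  {p | ∃ u, N.graph.Adj v u ∧ (A.run N n t u).2 = some t ∧ N.ident u = p.1 ∧
    A.send (A.run N n t u).1 (N.ident v) = some p.2}

theorem run_succ_of_awake {t : ℕ} {v : V} (h : (A.run N n t v).2 = some t) :
    A.run N n (t + 1) v = (A.step (A.run N n t v).1 (A.inbox N n t v),
      (A.sleep (A.step (A.run N n t v).1 (A.inbox N n t v))).map (fun k => t + 1 + k)) := by
  rw [run, if_pos h]
  rfl

theorem run_succ_of_not_awake {t : ℕ} {v : V} (h : (A.run N n t v).2 ≠ some t) :
    A.run N n (t + 1) v = A.run N n t v := by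
  rw [run, if_neg h]

theorem run_of_asleep {t t' t'' : ℕ} {v : V} (h : (A.run N n t v).2 = some t')
    (h₁ : t ≤ t'') (h₂ : t'' ≤ t') : A.run N n t'' v = A.run N n t v := by
  induction t'', h₁ using Nat.le_induction with
  | base => rfl
  | succ m hm ih =>
    have e := ih (by omega)
    rw [run_succ_of_not_awake, e]
    rw [e, h]
    simp
    omega

theorem run_of_terminated {t t'' : ℕ} {v : V} (h : (A.run N n t v).2 = none)
    (h₁ : t ≤ t'') : A.run N n t'' v = A.run N n t v := by
  induction t'', h₁ using Nat.le_induction with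
  | base => rfl
  | succ m hm ih =>
    rw [run_succ_of_not_awake, ih]
    rw [ih, h]
    simp

/-- One awake round followed by the sleep that it fixes. -/
theorem run_segment {t k t' : ℕ} {v : V} (h : (A.run N n t v).2 = some t)
    (hk : A.sleep (A.step (A.run N n t v).1 (A.inbox N n t v)) = some k)
    (h₁ : t + 1 ≤ t') (h₂ : t' ≤ t + 1 + k) :
    A.run N n t' v = (A.step (A.run N n t v).1 (A.inbox N n t v), some (t + 1 + k)) := by
  have e := A.run_succ_of_awake N n h
  rw [hk, Option.map_some] at e
  rw [A.run_of_asleep N n (t := t + 1) (t' := t + 1 + k) (by rw [e]) h₁ h₂, e]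

end SleepingAlgorithm

/-! ### Staged protocols -/

/-- A protocol that proceeds in stages. At the start of a stage every node carries some data, among
them a parent pointer and a label, which is larger than the label of the parent. In a stage, the
nodes first exchange messages with all neighbours, then values are aggregated from the children to
the parents, and finally values are propagated from the parents to the children. The first argument
of most functions is the global parameter, the second one the index of the stage. -/
structure StagedProtocol where
  /-- data of a node between stages -/
  Data : Type
  /-- messages for all neighbours -/
  XMsg : Type
  /-- messages for the parent -/
  UMsg : Type
  /-- messages for the children -/
  DMsg : Type
  /-- encoding of messages for all neighbours, which carry the label of the sender -/
  encX : ℕ × XMsg → List Bool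
  /-- encoding of messages for the parent -/
  encU : UMsg → List Bool
  /-- encoding of messages for the children -/
  encD : DMsg → List Bool
  encX_injective : Function.Injective encX
  encU_injective : Function.Injective encU
  encD_injective : Function.Injective encD
  /-- initial data -/
  init : ℕ → LocalView → Data
  /-- an upper bound for the labels -/
  height : ℕ → ℕ
  /-- the number of stages -/
  stages : ℕ → ℕ
  /-- the label of a node -/
  label : Data → ℕ
  /-- the identifier of the parent of a node -/
  parent : Data → Option ℕ
  /-- message for all neighbours -/
  exch : ℕ → ℕ → Data → XMsg
  /-- message for the parent, from the messages of the neighbours and of the children -/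
  up : ℕ → ℕ → Data → Set (ℕ × ℕ × XMsg) → Set (ℕ × UMsg) → UMsg
  /-- message for the children -/
  down : ℕ → ℕ → Data → Set (ℕ × ℕ × XMsg) → Set (ℕ × UMsg) → Option DMsg → DMsg
  /-- data after the stage -/
  next : ℕ → ℕ → Data → Set (ℕ × ℕ × XMsg) → Set (ℕ × UMsg) → Option DMsg → Data
  /-- the output, after a final exchange of messages with all neighbours -/
  result : Data → Set (ℕ × ℕ × XMsg) → Set ℕ

namespace StagedProtocol

variable (P : StagedProtocol)

/-- The state of a node that executes a staged protocol. -/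
structure State where
  /-- the global parameter -/
  n : ℕ
  /-- the index of the stage -/
  stage : ℕ
  /-- the number of awake rounds of the stage that are over -/
  pc : ℕ
  /-- the data at the start of the stage -/
  data : P.Data
  /-- the label during the stage -/
  lab : ℕ
  /-- the label of the parent during the stage, `0` at a root -/
  plab : ℕ
  /-- the messages of the neighbours -/
  nbrMsgs : Set (ℕ × ℕ × P.XMsg)
  /-- the messages of the children -/
  childMsgs : Set (ℕ × P.UMsg)
  /-- the message of the parent -/
  parentMsg : Option P.DMsg

open Classical in
/-- The message of the parent among the received ones. -/
noncomputable def recvParent (p : Option ℕ) (I : Set (ℕ × List Bool)) : Option P.DMsg :=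
  if h : ∃ m, ∃ i, p = some i ∧ (i, P.encD m) ∈ I then some h.choose else none

/-- The transition of a node in an awake round. -/
noncomputable def stepState (s : P.State) (I : Set (ℕ × List Bool)) : P.State :=
  match s.pc with
  | 0 =>
    { s with
      pc := if s.stage < P.stages s.n then 1 else 5
      lab := P.label s.data
      plab := sInf {l | ∃ i x, P.parent s.data = some i ∧ (i, P.encX (l, x)) ∈ I}
      nbrMsgs := {p | (p.1, P.encX p.2) ∈ I}
      childMsgs := ∅
      parentMsg := none }
  | 1 => { s with pc := 2, childMsgs := {p | (p.1, P.encU p.2) ∈ I} }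
  | 2 => { s with pc := 3 }
  | 3 => { s with pc := 4, parentMsg := P.recvParent (P.parent s.data) I }
  | _ =>
    { s with
      pc := 0
      stage := s.stage + 1
      data := P.next s.n s.stage s.data s.nbrMsgs s.childMsgs s.parentMsg }

/-- The sleeping time after an awake round. -/
def sleepState (s : P.State) : Option ℕ :=
  match s.pc with
  | 0 => some (P.height s.n - s.lab)
  | 1 => some (P.height s.n - s.lab)
  | 2 => some (s.lab - s.plab - 1)
  | 3 => some (2 * s.plab)
  | 4 => some (s.lab - s.plab - 1)
  | _ => none

/-- The message that a node sends to the neighbour with identifier `i`. -/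
def sendState (s : P.State) (i : ℕ) : Option (List Bool) :=
  match s.pc with
  | 0 => some (P.encX (P.label s.data, P.exch s.n s.stage s.data))
  | 2 =>
    if P.parent s.data = some i then
      some (P.encU (P.up s.n s.stage s.data s.nbrMsgs s.childMsgs))
    else none
  | 4 => some (P.encD (P.down s.n s.stage s.data s.nbrMsgs s.childMsgs s.parentMsg))
  | _ => none

/-- The sleeping algorithm that executes a staged protocol. -/
noncomputable def toAlgorithm : SleepingAlgorithm where
  State := P.State
  init n w := ⟨n, 0, 0, P.init n w, 0, 0, ∅, ∅, none⟩
  send := P.sendState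
  step := P.stepState
  sleep := P.sleepState
  output s := P.result s.data s.nbrMsgs

theorem send_toAlgorithm (s : P.State) (i : ℕ) : P.toAlgorithm.send s i = P.sendState s i :=
  rfl

variable {V : Type} (N : ClusteredNetwork V) (n : ℕ)

/-- The messages that the neighbours of `v` send to all their neighbours in stage `j`. -/
def nbrMsgsOf (j : ℕ) (s : V → P.Data) (v : V) : Set (ℕ × ℕ × P.XMsg) :=
  {p | ∃ u, N.graph.Adj v u ∧ p = (N.ident u, P.label (s u), P.exch n j (s u))}

/-- The labels are positive, at most the height, and larger than the label of the parent, which is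
a neighbour. -/
structure ValidLabels (s : V → P.Data) : Prop where
  pos : ∀ v, 1 ≤ P.label (s v)
  le : ∀ v, P.label (s v) ≤ P.height n
  parent : ∀ v i, P.parent (s v) = some i →
    ∃ u, N.graph.Adj v u ∧ N.ident u = i ∧ P.label (s u) < P.label (s v)

/-- The effect of stage `j` on the data of the nodes, where `C v` and `r v` are the messages that
`v` receives from its children and from its parent. -/
structure Transition (j : ℕ) (s s' : V → P.Data) (C : V → Set (ℕ × P.UMsg))
    (r : V → Option P.DMsg) : Prop where
  child : ∀ v, C v = {p | ∃ u, N.graph.Adj v u ∧ P.parent (s u) = some (N.ident v) ∧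
    p = (N.ident u, P.up n j (s u) (P.nbrMsgsOf N n j s u) (C u))}
  root : ∀ v, P.parent (s v) = none → r v = none
  parent : ∀ v u, N.graph.Adj v u → P.parent (s v) = some (N.ident u) →
    r v = some (P.down n j (s u) (P.nbrMsgsOf N n j s u) (C u) (r u))
  next : ∀ v, s' v = P.next n j (s v) (P.nbrMsgsOf N n j s v) (C v) (r v)

/-- All messages of stage `j` have at most `B` bits. -/
structure ShortMessages (j : ℕ) (s : V → P.Data) (C : V → Set (ℕ × P.UMsg))
    (r : V → Option P.DMsg) (B : ℝ) : Prop where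
  up : ∀ v, ((P.encU (P.up n j (s v) (P.nbrMsgsOf N n j s v) (C v))).length : ℝ) ≤ B
  down : ∀ v, ((P.encD (P.down n j (s v) (P.nbrMsgsOf N n j s v) (C v) (r v))).length : ℝ) ≤ B

/-- All nodes start stage `j` in round `t`, with data `s`. -/
def Starts (t j : ℕ) (s : V → P.Data) : Prop :=
  ∀ v, (P.toAlgorithm.run N n t v).2 = some t ∧ (P.toAlgorithm.run N n t v).1.n = n ∧
    (P.toAlgorithm.run N n t v).1.stage = j ∧ (P.toAlgorithm.run N n t v).1.pc = 0 ∧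
    (P.toAlgorithm.run N n t v).1.data = s v

variable {P N n}

/-- All nodes are awake in the first round of a stage, so no message is lost, and `encX` is
injective, so decoding recovers exactly what was sent. -/
theorem nbrMsgs_of_starts {t j : ℕ} {s : V → P.Data} (h : P.Starts N n t j s) (v : V) :
    {p : ℕ × ℕ × P.XMsg | (p.1, P.encX p.2) ∈ P.toAlgorithm.inbox N n t v} =
      P.nbrMsgsOf N n j s v := by
  ext ⟨i, l, x⟩
  simp only [SleepingAlgorithm.inbox, nbrMsgsOf, Set.mem_ofPred_eq]
  refine exists_congr fun u => and_congr_right fun _ => ?_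
  obtain ⟨h1, h2, h3, h4, h5⟩ := h u
  have : P.toAlgorithm.send (P.toAlgorithm.run N n t u).1 (N.ident v) =
      some (P.encX (P.label (s u), P.exch n j (s u))) := by
    change P.sendState _ _ = _
    simp only [sendState, h4, h2, h3, h5]
  rw [this]
  simp only [h1, true_and, Option.some.injEq, P.encX_injective.eq_iff, Prod.mk.injEq]
  tauto

/-- The label of the parent, `0` at a root. -/
noncomputable def parentLabel (P : StagedProtocol) (N : ClusteredNetwork V) (s : V → P.Data)
    (v : V) : ℕ :=
  sInf {l | ∃ u, N.graph.Adj v u ∧ P.parent (s v) = some (N.ident u) ∧ l = P.label (s u)}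

theorem parentLabel_of_none {s : V → P.Data} {v : V} (h : P.parent (s v) = none) :
    P.parentLabel N s v = 0 := by
  simp [parentLabel, h]

theorem parentLabel_of_some {s : V → P.Data} {v u : V} (ha : N.graph.Adj v u)
    (h : P.parent (s v) = some (N.ident u)) : P.parentLabel N s v = P.label (s u) := by
  have : {l | ∃ u, N.graph.Adj v u ∧ P.parent (s v) = some (N.ident u) ∧ l = P.label (s u)} =
      {P.label (s u)} := by
    ext l
    simp only [Set.mem_ofPred_eq, Set.mem_singleton_iff, h, Option.some.injEq,
      N.ident.injective.eq_iff]
    constructor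
    · rintro ⟨w, _, rfl, rfl⟩
      rfl
    · rintro rfl
      exact ⟨u, ha, rfl, rfl⟩
  rw [parentLabel, this, csInf_singleton]

theorem parentLabel_lt {s : V → P.Data} (hs : P.ValidLabels N n s) (v : V) :
    P.parentLabel N s v < P.label (s v) := by
  rcases h : P.parent (s v) with _ | i
  · rw [parentLabel_of_none h]
    exact hs.pos v
  · obtain ⟨u, ha, rfl, hl⟩ := hs.parent v i h
    rwa [parentLabel_of_some ha h]

end StagedProtocol

/-! ### The timetable of a stage -/

namespace StagedProtocol

variable (P : StagedProtocol) {V : Type} (N : ClusteredNetwork V) (n : ℕ)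

/-- The messages that `v` receives from its children in the stage starting in round `t`. -/
def stageChildMsgs (t : ℕ) (s : V → P.Data) (v : V) : Set (ℕ × P.UMsg) :=
  {p | (p.1, P.encU p.2) ∈ P.toAlgorithm.inbox N n (t + P.height n + 1 - P.label (s v)) v}

/-- The message that `v` receives from its parent in the stage starting in round `t`. -/
noncomputable def stageParentMsg (t : ℕ) (s : V → P.Data) (v : V) : Option P.DMsg :=
  P.recvParent (P.parent (s v))
    (P.toAlgorithm.inbox N n (t + P.height n + 2 + P.parentLabel N s v) v)

/-- The state of `v` after `k` awake rounds of stage `j`, if `C` and `r` are the messages received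
from the children and the parent. -/
noncomputable def midState (j : ℕ) (s : V → P.Data) (v : V) (k : ℕ) (C : Set (ℕ × P.UMsg))
    (r : Option P.DMsg) : P.State :=
  ⟨n, j, k, s v, P.label (s v), P.parentLabel N s v, P.nbrMsgsOf N n j s v, C, r⟩

variable {P N n}

/-- This lemma and the next four follow a node with label `l` and parent label `p` through its awake
rounds. With `H` the height, these are `t`, `t + H + 1 - l`, `t + H + 1 - p`, `t + H + 2 + p` and `t
+ H + 2 + l`, in increasing order because `p < l ≤ H`. The third and fourth are the second and fifth
of the parent, so parent and child meet once on the way up and once on the way down. -/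
theorem run_exch {t j : ℕ} {s : V → P.Data} (h : P.Starts N n t j s) (hs : P.ValidLabels N n s)
    (hj : j < P.stages n) (v : V) {t' : ℕ} (h₁ : t + 1 ≤ t')
    (h₂ : t' ≤ t + P.height n + 1 - P.label (s v)) :
    P.toAlgorithm.run N n t' v =
      (P.midState N n j s v 1 ∅ none, some (t + P.height n + 1 - P.label (s v))) := by
  have hle := hs.le v
  obtain ⟨h1, h2, h3, h4, h5⟩ := h v
  have hI := nbrMsgs_of_starts h v
  have hstep : P.toAlgorithm.step (P.toAlgorithm.run N n t v).1 (P.toAlgorithm.inbox N n t v) =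
      P.midState N n j s v 1 ∅ none := by
    change P.stepState _ _ = _
    have hp : sInf {l | ∃ i x, P.parent (s v) = some i ∧
        (i, P.encX (l, x)) ∈ P.toAlgorithm.inbox N n t v} = P.parentLabel N s v := by
      unfold parentLabel
      congr 1
      ext l
      have hm : ∀ i x, (i, P.encX (l, x)) ∈ P.toAlgorithm.inbox N n t v ↔
          (i, l, x) ∈ P.nbrMsgsOf N n j s v := by
        intro i x
        rw [← hI]
        rfl
      simp only [hm, nbrMsgsOf, Set.mem_ofPred_eq, Prod.mk.injEq]
      constructor
      · rintro ⟨i, x, hi, u, ha, rfl, hl, -⟩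
        exact ⟨u, ha, hi, hl⟩
      · rintro ⟨u, ha, hi, hl⟩
        exact ⟨_, _, hi, u, ha, rfl, hl, rfl⟩
    simp only [stepState, h4, h2, h3, h5, hp, hI, hj, if_true, midState]
  have := P.toAlgorithm.run_segment N n (k := P.height n - P.label (s v)) (t' := t') h1
    (by rw [hstep]; rfl) h₁ (by omega)
  rw [this, hstep]
  congr 2
  omega

theorem run_gather {t j : ℕ} {s : V → P.Data} (h : P.Starts N n t j s)
    (hs : P.ValidLabels N n s) (hj : j < P.stages n) (v : V) {t' : ℕ}
    (h₁ : t + P.height n + 2 - P.label (s v) ≤ t')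
    (h₂ : t' ≤ t + P.height n + 1 - P.parentLabel N s v) :
    P.toAlgorithm.run N n t' v = (P.midState N n j s v 2 (P.stageChildMsgs N n t s v) none,
      some (t + P.height n + 1 - P.parentLabel N s v)) := by
  have hle := hs.le v
  have hlt := parentLabel_lt hs v
  have e := run_exch h hs hj v (t' := t + P.height n + 1 - P.label (s v)) (by omega) le_rfl
  have hstep : P.toAlgorithm.step
      (P.toAlgorithm.run N n (t + P.height n + 1 - P.label (s v)) v).1
      (P.toAlgorithm.inbox N n (t + P.height n + 1 - P.label (s v)) v) =
      P.midState N n j s v 2 (P.stageChildMsgs N n t s v) none := by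
    rw [e]
    rfl
  have := P.toAlgorithm.run_segment N n (k := P.label (s v) - P.parentLabel N s v - 1) (t' := t')
    (by rw [e]) (by rw [hstep]; rfl) (by omega) (by omega)
  rw [this, hstep]
  congr 2
  omega

theorem run_report {t j : ℕ} {s : V → P.Data} (h : P.Starts N n t j s)
    (hs : P.ValidLabels N n s) (hj : j < P.stages n) (v : V) {t' : ℕ}
    (h₁ : t + P.height n + 2 - P.parentLabel N s v ≤ t')
    (h₂ : t' ≤ t + P.height n + 2 + P.parentLabel N s v) :
    P.toAlgorithm.run N n t' v = (P.midState N n j s v 3 (P.stageChildMsgs N n t s v) none,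
      some (t + P.height n + 2 + P.parentLabel N s v)) := by
  have hle := hs.le v
  have hlt := parentLabel_lt hs v
  have e := run_gather h hs hj v (t' := t + P.height n + 1 - P.parentLabel N s v) (by omega) le_rfl
  have hstep : P.toAlgorithm.step
      (P.toAlgorithm.run N n (t + P.height n + 1 - P.parentLabel N s v) v).1
      (P.toAlgorithm.inbox N n (t + P.height n + 1 - P.parentLabel N s v) v) =
      P.midState N n j s v 3 (P.stageChildMsgs N n t s v) none := by
    rw [e]
    rfl
  have := P.toAlgorithm.run_segment N n (k := 2 * P.parentLabel N s v) (t' := t')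
    (by rw [e]) (by rw [hstep]; rfl) (by omega) (by omega)
  rw [this, hstep]
  congr 2
  omega

theorem run_listen {t j : ℕ} {s : V → P.Data} (h : P.Starts N n t j s)
    (hs : P.ValidLabels N n s) (hj : j < P.stages n) (v : V) {t' : ℕ}
    (h₁ : t + P.height n + 3 + P.parentLabel N s v ≤ t')
    (h₂ : t' ≤ t + P.height n + 2 + P.label (s v)) :
    P.toAlgorithm.run N n t' v = (P.midState N n j s v 4 (P.stageChildMsgs N n t s v)
      (P.stageParentMsg N n t s v), some (t + P.height n + 2 + P.label (s v))) := by
  have hle := hs.le v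
  have hlt := parentLabel_lt hs v
  have e := run_report h hs hj v (t' := t + P.height n + 2 + P.parentLabel N s v) (by omega) le_rfl
  have hstep : P.toAlgorithm.step
      (P.toAlgorithm.run N n (t + P.height n + 2 + P.parentLabel N s v) v).1
      (P.toAlgorithm.inbox N n (t + P.height n + 2 + P.parentLabel N s v) v) =
      P.midState N n j s v 4 (P.stageChildMsgs N n t s v) (P.stageParentMsg N n t s v) := by
    rw [e]
    rfl
  have := P.toAlgorithm.run_segment N n (k := P.label (s v) - P.parentLabel N s v - 1) (t' := t')
    (by rw [e]) (by rw [hstep]; rfl) (by omega) (by omega)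
  rw [this, hstep]
  congr 2
  omega

theorem run_tell {t j : ℕ} {s : V → P.Data} (h : P.Starts N n t j s)
    (hs : P.ValidLabels N n s) (hj : j < P.stages n) (v : V) {t' : ℕ}
    (h₁ : t + P.height n + 3 + P.label (s v) ≤ t')
    (h₂ : t' ≤ t + (2 * P.height n + 3)) :
    P.toAlgorithm.run N n t' v = (⟨n, j + 1, 0, P.next n j (s v) (P.nbrMsgsOf N n j s v)
      (P.stageChildMsgs N n t s v) (P.stageParentMsg N n t s v), P.label (s v),
      P.parentLabel N s v, P.nbrMsgsOf N n j s v, P.stageChildMsgs N n t s v,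
      P.stageParentMsg N n t s v⟩, some (t + (2 * P.height n + 3))) := by
  have hle := hs.le v
  have hlt := parentLabel_lt hs v
  have e := run_listen h hs hj v (t' := t + P.height n + 2 + P.label (s v)) (by omega) le_rfl
  have hstep : P.toAlgorithm.step
      (P.toAlgorithm.run N n (t + P.height n + 2 + P.label (s v)) v).1
      (P.toAlgorithm.inbox N n (t + P.height n + 2 + P.label (s v)) v) =
      ⟨n, j + 1, 0, P.next n j (s v) (P.nbrMsgsOf N n j s v)
      (P.stageChildMsgs N n t s v) (P.stageParentMsg N n t s v), P.label (s v),
      P.parentLabel N s v, P.nbrMsgsOf N n j s v, P.stageChildMsgs N n t s v,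
      P.stageParentMsg N n t s v⟩ := by
    rw [e]
    rfl
  have := P.toAlgorithm.run_segment N n (k := P.height n - P.label (s v)) (t' := t')
    (by rw [e]) (by rw [hstep]; rfl) (by omega) (by omega)
  rw [this, hstep]
  congr 2
  omega

/-- The five awake rounds of a node in a stage, and its states in these rounds. -/
theorem awake_cases {t j : ℕ} {s : V → P.Data} (h : P.Starts N n t j s)
    (hs : P.ValidLabels N n s) (hj : j < P.stages n) (v : V) {t' : ℕ} (h₁ : t ≤ t')
    (h₂ : t' < t + (2 * P.height n + 3)) (ha : (P.toAlgorithm.run N n t' v).2 = some t') :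
    t' = t ∨
    (t' = t + P.height n + 1 - P.label (s v) ∧
      (P.toAlgorithm.run N n t' v).1 = P.midState N n j s v 1 ∅ none) ∨
    (t' = t + P.height n + 1 - P.parentLabel N s v ∧
      (P.toAlgorithm.run N n t' v).1 =
        P.midState N n j s v 2 (P.stageChildMsgs N n t s v) none) ∨
    (t' = t + P.height n + 2 + P.parentLabel N s v ∧
      (P.toAlgorithm.run N n t' v).1 =
        P.midState N n j s v 3 (P.stageChildMsgs N n t s v) none) ∨
    (t' = t + P.height n + 2 + P.label (s v) ∧
      (P.toAlgorithm.run N n t' v).1 =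
        P.midState N n j s v 4 (P.stageChildMsgs N n t s v) (P.stageParentMsg N n t s v)) := by
  have hle := hs.le v
  have hlt := parentLabel_lt hs v
  by_cases c0 : t' = t
  · exact Or.inl c0
  by_cases c1 : t' ≤ t + P.height n + 1 - P.label (s v)
  · have e := run_exch h hs hj v (by omega) c1
    rw [e] at ha ⊢
    simp only [Option.some.injEq] at ha
    exact Or.inr (Or.inl ⟨ha.symm, rfl⟩)
  by_cases c2 : t' ≤ t + P.height n + 1 - P.parentLabel N s v
  · have e := run_gather h hs hj v (by omega) c2
    rw [e] at ha ⊢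
    simp only [Option.some.injEq] at ha
    exact Or.inr (Or.inr (Or.inl ⟨ha.symm, rfl⟩))
  by_cases c3 : t' ≤ t + P.height n + 2 + P.parentLabel N s v
  · have e := run_report h hs hj v (by omega) c3
    rw [e] at ha ⊢
    simp only [Option.some.injEq] at ha
    exact Or.inr (Or.inr (Or.inr (Or.inl ⟨ha.symm, rfl⟩)))
  by_cases c4 : t' ≤ t + P.height n + 2 + P.label (s v)
  · have e := run_listen h hs hj v (by omega) c4
    rw [e] at ha ⊢
    simp only [Option.some.injEq] at ha
    exact Or.inr (Or.inr (Or.inr (Or.inr ⟨ha.symm, rfl⟩)))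
  · have e := run_tell h hs hj v (t' := t') (by omega) (by omega)
    rw [e] at ha
    simp only [Option.some.injEq] at ha
    omega

/-- A stage started with valid labels has the specified effect. -/
theorem exists_transition {t j : ℕ} {s : V → P.Data} (h : P.Starts N n t j s)
    (hs : P.ValidLabels N n s) (hj : j < P.stages n) :
    ∃ s', P.Transition N n j s s' (P.stageChildMsgs N n t s) (P.stageParentMsg N n t s) ∧
      P.Starts N n (t + (2 * P.height n + 3)) (j + 1) s' := by
  refine ⟨fun v => P.next n j (s v) (P.nbrMsgsOf N n j s v) (P.stageChildMsgs N n t s v)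
    (P.stageParentMsg N n t s v), ⟨?_, ?_, ?_, fun _ => rfl⟩, ?_⟩
  · intro v
    have hlev := hs.le v
    have hlv := parentLabel_lt hs v
    ext ⟨i, m⟩
    simp only [stageChildMsgs, SleepingAlgorithm.inbox, Set.mem_ofPred_eq, Prod.mk.injEq]
    refine exists_congr fun u => and_congr_right fun hvu => ?_
    have hleu := hs.le u
    have hlu := parentLabel_lt hs u
    constructor
    · rintro ⟨ha, hi, hm⟩
      -- A neighbour that is awake while `v` listens to its children either listens as well, hence
      -- is silent, or reports, hence only to its parent. The round rules out its other three awake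
      -- rounds.
      rcases awake_cases h hs hj u (by omega) (by omega) ha with
        e | ⟨e, e'⟩ | ⟨e, e'⟩ | ⟨e, e'⟩ | ⟨e, e'⟩
      · omega
      · rw [e'] at hm
        exact absurd hm (by simp [toAlgorithm, sendState, midState])
      · rw [e'] at hm
        simp only [send_toAlgorithm, sendState, midState] at hm
        split_ifs at hm with hp
        rw [Option.some.injEq] at hm
        exact ⟨hp, hi.symm, (P.encU_injective hm).symm⟩
      · omega
      · omega
    · rintro ⟨hp, rfl, rfl⟩
      have hpl := parentLabel_of_some hvu.symm hp
      have e := run_gather h hs hj u (t' := t + P.height n + 1 - P.label (s v)) (by omega)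
        (by omega)
      rw [e]
      refine ⟨by rw [hpl], rfl, ?_⟩
      rw [send_toAlgorithm]
      simp only [sendState, midState]
      exact if_pos hp
  · intro v hv
    simp [stageParentMsg, recvParent, hv]
  · intro v u hvu hp
    have hlev := hs.le v
    have hlv := parentLabel_lt hs v
    have hleu := hs.le u
    have hlu := parentLabel_lt hs u
    have hpl := parentLabel_of_some hvu hp
    -- Other neighbours may be sending in this round, too. The identifier of the sender singles out
    -- `u`, and injectivity of `encD` makes the message unique, so the choice in `recvParent` is
    -- harmless.
    have key : ∀ m, (N.ident u, P.encD m) ∈ P.toAlgorithm.inbox N n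
        (t + P.height n + 2 + P.parentLabel N s v) v ↔
        m = P.down n j (s u) (P.nbrMsgsOf N n j s u) (P.stageChildMsgs N n t s u)
          (P.stageParentMsg N n t s u) := by
      intro m
      have e := run_listen h hs hj u (t' := t + P.height n + 2 + P.label (s u)) (by omega) le_rfl
      have e' : P.toAlgorithm.send (P.midState N n j s u 4 (P.stageChildMsgs N n t s u)
          (P.stageParentMsg N n t s u)) (N.ident v) =
          some (P.encD (P.down n j (s u) (P.nbrMsgsOf N n j s u) (P.stageChildMsgs N n t s u)
          (P.stageParentMsg N n t s u))) := rfl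
      simp only [SleepingAlgorithm.inbox, Set.mem_ofPred_eq, hpl]
      constructor
      · rintro ⟨w, -, -, hw, hm⟩
        rw [N.ident.injective hw, e, e', Option.some.injEq] at hm
        exact (P.encD_injective hm).symm
      · rintro rfl
        exact ⟨u, hvu, by rw [e], rfl, by rw [e, e']⟩
    have hex : ∃ m, ∃ i, P.parent (s v) = some i ∧ (i, P.encD m) ∈ P.toAlgorithm.inbox N n
        (t + P.height n + 2 + P.parentLabel N s v) v := ⟨_, _, hp, (key _).2 rfl⟩
    rw [stageParentMsg, recvParent, dif_pos hex, Option.some.injEq]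
    obtain ⟨i, hi, hm⟩ := hex.choose_spec
    rw [hp, Option.some.injEq] at hi
    subst hi
    exact (key _).1 hm
  · intro v
    have hle := hs.le v
    have e := run_tell h hs hj v (t' := t + (2 * P.height n + 3)) (by omega) le_rfl
    rw [e]
    exact ⟨rfl, rfl, rfl, rfl, rfl⟩

/-! ### Awake time and message lengths of a whole execution -/

theorem ncard_awake_stage_le {t j : ℕ} {s : V → P.Data} (h : P.Starts N n t j s)
    (hs : P.ValidLabels N n s) (hj : j < P.stages n) (v : V) :
    {t' | t ≤ t' ∧ t' < t + (2 * P.height n + 3) ∧ P.toAlgorithm.Awake N n t' v}.ncard ≤ 5 := by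
  classical
  refine (Set.ncard_le_ncard (t := (({t, t + P.height n + 1 - P.label (s v),
    t + P.height n + 1 - P.parentLabel N s v, t + P.height n + 2 + P.parentLabel N s v,
    t + P.height n + 2 + P.label (s v)} : Finset ℕ) : Set ℕ)) ?_ (Finset.finite_toSet _)).trans ?_
  · rintro t' ⟨h1, h2, h3⟩
    simp only [Finset.coe_insert, Finset.coe_singleton, Set.mem_insert_iff, Set.mem_singleton_iff]
    rcases awake_cases h hs hj v h1 h2 h3 with e | ⟨e, -⟩ | ⟨e, -⟩ | ⟨e, -⟩ | ⟨e, -⟩ <;> simp [e]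
  · rw [Set.ncard_coe_finset]
    exact Finset.card_le_five

theorem length_send_le_of_starts {t j : ℕ} {s : V → P.Data} {B : ℝ} (h : P.Starts N n t j s)
    (hB : ∀ v, ((P.encX (P.label (s v), P.exch n j (s v))).length : ℝ) ≤ B) (v : V) (i : ℕ)
    (m : List Bool) (hm : P.toAlgorithm.send (P.toAlgorithm.run N n t v).1 i = some m) :
    (m.length : ℝ) ≤ B := by
  obtain ⟨h1, h2, h3, h4, h5⟩ := h v
  change P.sendState _ _ = _ at hm
  simp only [sendState, h4, h2, h3, h5, Option.some.injEq] at hm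
  rw [← hm]
  exact hB v

theorem length_send_le_of_stage {t j : ℕ} {s : V → P.Data} {B : ℝ} (h : P.Starts N n t j s)
    (hs : P.ValidLabels N n s) (hj : j < P.stages n)
    (hX : ∀ v, ((P.encX (P.label (s v), P.exch n j (s v))).length : ℝ) ≤ B)
    (hB : P.ShortMessages N n j s (P.stageChildMsgs N n t s) (P.stageParentMsg N n t s) B)
    (v : V) (i : ℕ) {t' : ℕ} (h₁ : t ≤ t') (h₂ : t' < t + (2 * P.height n + 3))
    (ha : P.toAlgorithm.Awake N n t' v) (m : List Bool)
    (hm : P.toAlgorithm.send (P.toAlgorithm.run N n t' v).1 i = some m) :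
    (m.length : ℝ) ≤ B := by
  rcases awake_cases h hs hj v h₁ h₂ ha with rfl | ⟨e, e'⟩ | ⟨e, e'⟩ | ⟨e, e'⟩ | ⟨e, e'⟩
  · exact length_send_le_of_starts h hX v i m hm
  all_goals
    rw [e'] at hm
    simp only [send_toAlgorithm, sendState, midState] at hm
  · exact absurd hm (by simp)
  · split_ifs at hm
    rw [Option.some.injEq] at hm
    rw [← hm]
    exact hB.up v
  · exact absurd hm (by simp)
  · rw [Option.some.injEq] at hm
    rw [← hm]
    exact hB.down v

/-- An invariant that is preserved by all stages holds for the data at the end of the execution of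
a staged protocol. Every node is awake in at most five rounds of every stage. -/
theorem execution [Finite V] {B : ℝ} (I : ℕ → (V → P.Data) → Prop)
    (init : I 0 (fun v => P.init n (N.view v)))
    (valid : ∀ j s, j < P.stages n → I j s → P.ValidLabels N n s)
    (short : ∀ j s, j ≤ P.stages n → I j s →
      ∀ v, ((P.encX (P.label (s v), P.exch n j (s v))).length : ℝ) ≤ B)
    (step : ∀ j s s' C r, j < P.stages n → I j s → P.Transition N n j s s' C r →
      I (j + 1) s' ∧ P.ShortMessages N n j s C r B) :
    P.toAlgorithm.MessagesBoundedBy N n B ∧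
    ∃ s, I (P.stages n) s ∧ ∀ v,
      P.toAlgorithm.TerminatesWithin N n (P.stages n * (2 * P.height n + 3) + 1) v ∧
      P.toAlgorithm.awakeRounds N n (P.stages n * (2 * P.height n + 3) + 1) v ≤
        5 * P.stages n + 1 ∧
      P.toAlgorithm.output
        (P.toAlgorithm.run N n (P.stages n * (2 * P.height n + 3) + 1) v).1 =
        P.result (s v) (P.nbrMsgsOf N n (P.stages n) s v) := by
  have main : ∀ j ≤ P.stages n, ∃ s, I j s ∧ P.Starts N n (j * (2 * P.height n + 3)) j s ∧
      (∀ v, {t | t < j * (2 * P.height n + 3) ∧ P.toAlgorithm.Awake N n t v}.ncard ≤ 5 * j) ∧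
      ∀ t < j * (2 * P.height n + 3), ∀ v i, P.toAlgorithm.Awake N n t v → ∀ m,
        P.toAlgorithm.send (P.toAlgorithm.run N n t v).1 i = some m → (m.length : ℝ) ≤ B := by
    intro j
    induction j with
    | zero =>
      intro _
      refine ⟨_, init, ?_, ?_, ?_⟩
      · intro v
        rw [zero_mul]
        exact ⟨rfl, rfl, rfl, rfl, rfl⟩
      · simp
      · simp
    | succ j ih =>
      intro hj
      obtain ⟨s, hI, hS, hA, hM⟩ := ih (by omega)
      have hv := valid j s (by omega) hI
      obtain ⟨s', hT, hS'⟩ := exists_transition hS hv (by omega)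
      obtain ⟨hI', hB⟩ := step j s s' _ _ (by omega) hI hT
      rw [add_mul, one_mul]
      refine ⟨s', hI', hS', ?_, ?_⟩
      · intro v
        have e : {t | t < j * (2 * P.height n + 3) + (2 * P.height n + 3) ∧
            P.toAlgorithm.Awake N n t v} =
            {t | t < j * (2 * P.height n + 3) ∧ P.toAlgorithm.Awake N n t v} ∪
            {t | j * (2 * P.height n + 3) ≤ t ∧
              t < j * (2 * P.height n + 3) + (2 * P.height n + 3) ∧
              P.toAlgorithm.Awake N n t v} := by
          ext t
          simp only [Set.mem_ofPred_eq, Set.mem_union]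
          by_cases ht : t < j * (2 * P.height n + 3)
          · simp [ht, Nat.lt_add_right]
          · simp [ht, not_lt.1 ht]
        rw [e]
        refine (Set.ncard_union_le _ _).trans ?_
        have := hA v
        have := ncard_awake_stage_le hS hv (by omega) v
        omega
      · intro t ht v i ha m hm
        by_cases ht' : t < j * (2 * P.height n + 3)
        · exact hM t ht' v i ha m hm
        · exact length_send_le_of_stage hS hv (by omega) (short j s (by omega) hI) hB v i
            (by omega) ht ha m hm
  obtain ⟨s, hI, hS, hA, hM⟩ := main _ le_rfl
  have hX := short _ s le_rfl hI
  set R := P.stages n * (2 * P.height n + 3) with hR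
  -- After the last stage there is only one more exchange: the counter jumps to `5`, at which
  -- `sleepState` is `none`. This accounts for the `+ 1` in both bounds.
  have hlast : ∀ v, P.toAlgorithm.run N n (R + 1) v =
      (P.toAlgorithm.step (P.toAlgorithm.run N n R v).1 (P.toAlgorithm.inbox N n R v), none) := by
    intro v
    obtain ⟨h1, h2, h3, h4, h5⟩ := hS v
    rw [P.toAlgorithm.run_succ_of_awake N n h1]
    congr 1
    change Option.map _ (P.sleepState (P.stepState _ _)) = _
    simp [stepState, sleepState, h4, h2, h3]
  refine ⟨?_, s, hI, fun v => ⟨?_, ?_, ?_⟩⟩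
  · intro t v u ha _ m hm
    rcases lt_trichotomy t R with ht | rfl | ht
    · exact hM t ht v _ ha m hm
    · exact length_send_le_of_starts hS hX v _ m hm
    · have := P.toAlgorithm.run_of_terminated N n (t := R + 1) (t'' := t) (v := v)
        (by rw [hlast]) ht
      rw [SleepingAlgorithm.Awake, this, hlast] at ha
      exact absurd ha (by simp)
  · rw [SleepingAlgorithm.TerminatesWithin, hlast]
  · rw [SleepingAlgorithm.awakeRounds]
    refine (Set.ncard_le_ncard (t := {t | t < R ∧ P.toAlgorithm.Awake N n t v} ∪ {R}) ?_
      (((Set.finite_lt_nat R).subset fun t ht => ht.1).union (Set.finite_singleton R))).trans ?_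
    · rintro t ⟨h1, h2⟩
      rcases Nat.lt_succ_iff_lt_or_eq.1 h1 with h | rfl
      · exact Or.inl ⟨h, h2⟩
      · exact Or.inr rfl
    · refine (Set.ncard_union_le _ _).trans ?_
      rw [Set.ncard_singleton]
      exact Nat.add_le_add_right (hA v) 1
  · rw [hlast]
    obtain ⟨h1, h2, h3, h4, h5⟩ := hS v
    have hI := nbrMsgs_of_starts hS v
    change P.result (P.stepState _ _).data (P.stepState _ _).nbrMsgs = _
    simp only [stepState, h4, h5, hI]

end StagedProtocol

/-! ### Colour reduction -/

/-- A Cole–Vishkin step: the position of the lowest bit in which the numbers differ, and the value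
of this bit in the first number. -/
noncomputable def coleVishkin (x y : ℕ) : ℕ :=
  2 * sInf {i | x.testBit i ≠ y.testBit i} + (x.testBit (sInf {i | x.testBit i ≠ y.testBit i})).toNat

/-- Equal values would mean the same position and the same bit there in `x` and in `y`, but `x` and
`y` differ at the position chosen for `x`. Nothing about `z` is needed, so the successor on the far
side may be arbitrary. -/
theorem coleVishkin_ne {x y z : ℕ} (h₁ : x ≠ y) :
    coleVishkin x y ≠ coleVishkin y z := by
  intro h
  have n₁ : {i | x.testBit i ≠ y.testBit i}.Nonempty := by
    by_contra hc
    exact h₁ (Nat.eq_of_testBit_eq fun i => by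
      by_contra hi
      exact hc ⟨i, hi⟩)
  have m₁ := Nat.sInf_mem n₁
  simp only [coleVishkin] at h
  have e₁ := Bool.toNat_lt (x.testBit (sInf {i | x.testBit i ≠ y.testBit i}))
  have e₂ := Bool.toNat_lt (y.testBit (sInf {i | y.testBit i ≠ z.testBit i}))
  have e : sInf {i | x.testBit i ≠ y.testBit i} = sInf {i | y.testBit i ≠ z.testBit i} := by omega
  rw [← e] at h
  have inj : ∀ b c : Bool, b.toNat = c.toNat → b = c := by decide
  exact m₁ (inj _ _ (by omega))

theorem coleVishkin_lt {x y m : ℕ} (hm : 1 ≤ m) (hx : x < 2 ^ m) (hy : y < 2 ^ m) :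
    coleVishkin x y < 2 * m := by
  have e₁ := Bool.toNat_lt (x.testBit (sInf {i | x.testBit i ≠ y.testBit i}))
  have : sInf {i | x.testBit i ≠ y.testBit i} < m := by
    -- For `x = y` the infimum of the empty set is `0`, which is below `m` since `1 ≤ m`.
    rcases Set.eq_empty_or_nonempty {i | x.testBit i ≠ y.testBit i} with h | h
    · rw [h, Nat.sInf_empty]
      exact hm
    · by_contra hc
      have hm := Nat.sInf_mem h
      have h1 : m ≤ sInf {i | x.testBit i ≠ y.testBit i} := not_lt.1 hc
      have h2 := Nat.pow_le_pow_right (n := 2) (by norm_num) h1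
      exact hm (by rw [Nat.testBit_eq_false_of_lt (hx.trans_le h2),
        Nat.testBit_eq_false_of_lt (hy.trans_le h2)])
  unfold coleVishkin
  omega

/-! ### Encoding of messages -/

theorem Nat.bits_injective : Function.Injective Nat.bits := by
  intro x y h
  have := congrArg (List.map fun b : Bool => cond b 1 0) h
  rw [← Nat.digits_two_eq_bits, ← Nat.digits_two_eq_bits] at this
  exact Nat.digits.injective 2 this

/-- The bit string that encodes a message. -/
def bitCode {α : Type} [Encodable α] (a : α) : List Bool :=
  (Encodable.encode a).bits

theorem bitCode_injective {α : Type} [Encodable α] : Function.Injective (bitCode (α := α)) :=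
  Nat.bits_injective.comp Encodable.encode_injective

theorem length_bitCode_le {α : Type} [Encodable α] {a : α} {B : ℕ}
    (h : Encodable.encode a < 2 ^ B) : (bitCode a).length ≤ B := by
  rw [bitCode, Nat.size_eq_bits_len]
  exact Nat.size_le.2 h

/-- Pairing at most doubles the number of bits, so nested pairs of bounded depth cost only a
constant factor. -/
theorem Nat.pair_lt_two_pow {x y B : ℕ} (hx : x < 2 ^ B) (hy : y < 2 ^ B) :
    Nat.pair x y < 2 ^ (2 * B) := by
  refine (Nat.pair_lt_max_add_one_sq x y).trans_le ?_
  rw [mul_comm, pow_mul]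
  exact Nat.pow_le_pow_left (max_lt hx hy) 2

theorem encode_prod_lt {α β : Type} [Encodable α] [Encodable β] {a : α} {b : β} {B : ℕ}
    (ha : Encodable.encode a < 2 ^ B) (hb : Encodable.encode b < 2 ^ B) :
    Encodable.encode (a, b) < 2 ^ (2 * B) := by
  rw [Encodable.encode_prod_val]
  exact Nat.pair_lt_two_pow ha hb

theorem encode_option_lt {α : Type} [Encodable α] {a : Option α} {B : ℕ}
    (h : ∀ x, a = some x → Encodable.encode x < 2 ^ B) :
    Encodable.encode a < 2 ^ (B + 1) := by
  rcases a with _ | x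
  · rw [Encodable.encode_none]
    positivity
  · rw [Encodable.encode_some, pow_succ]
    have := h x rfl
    omega

/-! ### Clusters and rooted forests -/

namespace ClusteredNetwork

variable {V : Type} (N : ClusteredNetwork V)

/-- The graph of the edges inside the clusters. -/
def clusterGraph : SimpleGraph V where
  Adj v u := N.graph.Adj v u ∧ N.cluster v u
  symm := ⟨fun _ _ h => ⟨h.1.symm, N.cluster.symm' h.2⟩⟩
  loopless := ⟨fun v h => N.graph.loopless.irrefl v h.1⟩

theorem exists_clusterGraph_walk [Finite V] {D : ℕ}
    (h : ∀ C ∈ N.cluster.classes, (N.graph.induce C).Connected ∧ (N.graph.induce C).diam ≤ D)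
    {v u : V} (hvu : N.cluster v u) : ∃ p : N.clusterGraph.Walk v u, p.length ≤ D := by
  set C : Set V := {x | N.cluster x u} with hC
  obtain ⟨h1, h2⟩ := h C (Setoid.mem_classes N.cluster u)
  have : Nonempty C := ⟨⟨u, N.cluster.refl' u⟩⟩
  obtain ⟨p, hp⟩ := h1.exists_walk_length_eq_dist (⟨v, hvu⟩ : C) ⟨u, N.cluster.refl' u⟩
  -- Distances are bounded by `diam` only if the extended diameter is finite; connectedness of the
  -- finite cluster provides this.
  have hd := SimpleGraph.dist_le_diam (SimpleGraph.connected_iff_ediam_ne_top.1 h1)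
    (u := (⟨v, hvu⟩ : C)) (v := ⟨u, N.cluster.refl' u⟩)
  let f : N.graph.induce C →g N.clusterGraph :=
    ⟨Subtype.val, fun {x y} hxy => ⟨hxy, N.cluster.trans' x.2 (N.cluster.symm' y.2)⟩⟩
  refine ⟨p.map f, ?_⟩
  rw [SimpleGraph.Walk.length_map]
  omega

theorem card_le_ncard_classes [Finite V] {ι : Type} (f : ι → V)
    (h : ∀ i j, N.cluster (f i) (f j) → i = j) : Nat.card ι ≤ N.cluster.classes.ncard := by
  rw [← Nat.card_coe_set_eq]
  refine Nat.card_le_card_of_injective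
    (fun i => (⟨_, Setoid.mem_classes N.cluster (f i)⟩ : N.cluster.classes)) ?_
  intro i j hij
  have : f i ∈ {x | N.cluster x (f j)} := by
    rw [← Subtype.mk.inj hij]
    exact N.cluster.refl' _
  exact h i j this

end ClusteredNetwork

/-! ### The protocol -/

/-- The data of a node between two stages. -/
structure NodeData where
  /-- the identifier of the node -/
  id : ℕ
  /-- the identifiers of the neighbours in the same cluster -/
  mates : Set ℕ
  /-- the identifier of the parent -/
  parent : Option ℕ
  /-- a label that is larger than the label of the parent -/
  label : ℕ
  /-- the identifier of the fragment of the node -/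
  frag : ℕ
  /-- at a root: the identifier of a neighbour in another fragment -/
  hook : Option ℕ
  /-- the colour of the fragment -/
  color : ℕ

/-- The kinds of stages: `flood` distributes the minimal identifier in a cluster, `grow` extends the
trees of the clusters, and the other four make up a merging phase. -/
inductive StageKind
  | flood
  | grow
  | propose
  | color
  | orient
  | relabel

/-- An edge that leaves a fragment, as seen from a node of the fragment. -/
structure Offer where
  /-- the number of steps down to the endpoint in the fragment -/
  dist : ℕ
  /-- the fragment of the other endpoint -/
  target : ℕ
  /-- the endpoint in the fragment -/
  root : ℕ
  /-- the child on the way to the endpoint -/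
  child : Option ℕ
  /-- the other endpoint, at the endpoint in the fragment -/
  hook : Option ℕ

/-- The position of a node with respect to the edge that is chosen by its fragment. -/
structure Plan where
  /-- the fragment of the other endpoint -/
  target : Option ℕ
  /-- the child on the way to the edge, for nodes on the path from the root to the edge -/
  child : Option ℕ
  /-- the distance to the edge -/
  dist : ℕ
  /-- the endpoint in the fragment -/
  root : ℕ
  /-- the next node on the way to the edge -/
  parent : Option ℕ
  /-- the other endpoint, at the endpoint in the fragment -/
  hook : Option ℕ

/-- Messages for all neighbours. -/
abbrev NbrMsg := ℕ × Option ℕ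

/-- Messages for the parent. -/
abbrev ParentMsg := Option (ℕ × ℕ × ℕ)

/-- Messages for the children. -/
abbrev ChildMsg := Option ℕ × Option ℕ × ℕ × ℕ

namespace NodeData

variable (d : NodeData) (X : Set (ℕ × ℕ × NbrMsg)) (C : Set (ℕ × ParentMsg)) (r : Option ChildMsg)

/-- The node belongs to the tree of its cluster. -/
def Reached : Prop := d.parent ≠ none ∨ d.frag = d.id

/-- The edges that leave the fragment and that the node can offer to its parent: its own ones, and
the ones offered by its children. -/
def IsOffer (o : Offer) : Prop :=
  (∃ i l y, (i, l, o.target, y) ∈ X ∧ o.target ≠ d.frag ∧ o.dist = 0 ∧ o.root = d.id ∧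
    o.child = none ∧ o.hook = some i) ∨
  ∃ i k, (i, some (k, o.target, o.root)) ∈ C ∧ o.dist = k + 1 ∧ o.child = some i ∧ o.hook = none

open Classical in
/-- A chosen offer. -/
noncomputable def offer : Option Offer :=
  if h : ∃ o, d.IsOffer X C o then some h.choose else none

/-- The plan of a node on the path from the root to the chosen edge. -/
noncomputable def pathPlan : Plan :=
  match d.offer X C with
  | none => ⟨none, none, 0, d.id, none, none⟩
  | some o => ⟨some o.target, o.child, o.dist, o.root, o.child, o.hook⟩

/-- The plan of a node, given the message of the parent. -/
noncomputable def plan : Plan :=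
  match r with
  | none => d.pathPlan X C
  | some m =>
    if m.2.1 = some d.id then d.pathPlan X C
    else ⟨m.1, none, m.2.2.1 + 1, m.2.2.2, d.parent, none⟩

/-- The colour of the neighbour across the chosen edge. -/
noncomputable def hookColor : ℕ :=
  sInf {c | ∃ i l h, d.hook = some i ∧ (i, l, c, h) ∈ X}

/-- The second colour of the fragment, computed at the root. -/
noncomputable def newColor : ℕ :=
  match d.hook with
  | none => 0
  | some _ => coleVishkin d.color (d.hookColor X)

/-- The fragment at the other end of the edge chosen by the root is the new parent of its fragment:
its colour is smaller, or it is larger and the fragment has no hooked fragment of larger colour. -/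
def Attaches : Prop :=
  d.hook ≠ none ∧ (d.hookColor X < d.color ∨
    d.color < d.hookColor X ∧ (¬ ∃ i l c, (i, l, c, some d.id) ∈ X ∧ d.color < c) ∧
      ¬ ∃ i x, (i, some x) ∈ C)

open Classical in
/-- The time slot of a fragment, computed at the root, where `k` is the number of colours. -/
noncomputable def slot (k : ℕ) : ℕ :=
  -- Trees attaching towards a larger colour come after all others and in decreasing order of
  -- colours: if all colours are below `k`, then `2 * k - color` exceeds `k`.
  if d.Attaches X C ∧ d.color < d.hookColor X then 2 * k - d.color else d.color

end NodeData

/-- The parameters of the protocol. -/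
structure TreeParams where
  /-- an upper bound for the diameters of the clusters -/
  radius : ℕ
  /-- an upper bound for the number of nodes on a path to the root of a tree -/
  depth : ℕ
  /-- an upper bound for the final colours -/
  palette : ℕ
  /-- the number of phases -/
  phases : ℕ

namespace TreeParams

variable (p : TreeParams)

/-- The kinds of the stages of a merging phase. -/
def phaseKind : ℕ → StageKind
  | 0 => .propose
  | 1 => .color
  | 2 => .orient
  | _ => .relabel

/-- The kind of stage `j`. -/
def kind (j : ℕ) : StageKind :=
  if j < p.radius then .flood else if j < 2 * p.radius then .grow
  else phaseKind ((j - 2 * p.radius) % 4)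

open Classical in
/-- The message for all neighbours. -/
noncomputable def exch (k : StageKind) (d : NodeData) : NbrMsg :=
  match k with
  | .flood => (d.frag, none)
  | .grow => (if d.Reached then 1 else 0, none)
  | .propose => (d.frag, d.parent)
  | .color => (d.color, none)
  | .orient => (d.color, d.hook)
  | .relabel => (0, none)

open Classical in
/-- The message for the parent. -/
noncomputable def up (k : StageKind) (d : NodeData) (X : Set (ℕ × ℕ × NbrMsg))
    (C : Set (ℕ × ParentMsg)) : ParentMsg :=
  match k with
  | .propose => (d.offer X C).map fun o => (o.dist, o.target, o.root)
  | .orient =>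
    if (∃ i l c, (i, l, c, some d.id) ∈ X ∧ d.color < c) ∨ ∃ i x, (i, some x) ∈ C then
      some (0, 0, 0)
    else none
  | _ => none

/-- The message for the children. -/
noncomputable def down (k : StageKind) (d : NodeData) (X : Set (ℕ × ℕ × NbrMsg))
    (C : Set (ℕ × ParentMsg)) (r : Option ChildMsg) : ChildMsg :=
  match k with
  | .propose => ((d.plan X C r).target, (d.plan X C r).child, (d.plan X C r).dist,
      (d.plan X C r).root)
  | .color => (none, none, r.elim (d.newColor X) (fun m => m.2.2.1), 0)
  | .orient => (none, none, r.elim (d.slot X C p.palette) (fun m => m.2.2.1), 0)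
  | .relabel => (none, none, r.elim 1 (fun m => m.2.2.1 + 1), r.elim d.id (fun m => m.2.2.2))
  | _ => (none, none, 0, 0)

open Classical in
/-- The data after a stage. -/
noncomputable def next (k : StageKind) (d : NodeData) (X : Set (ℕ × ℕ × NbrMsg))
    (C : Set (ℕ × ParentMsg)) (r : Option ChildMsg) : NodeData :=
  match k with
  | .flood =>
    { d with frag := sInf ({d.frag} ∪ {q | ∃ i l y, (i, l, q, y) ∈ X ∧ i ∈ d.mates}) }
  | .grow =>
    if h : ¬ d.Reached ∧ ∃ e : ℕ × ℕ, ∃ y, (e.1, e.2, 1, y) ∈ X ∧ e.1 ∈ d.mates then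
      { d with parent := some h.2.choose.1, label := h.2.choose.2 + 1 }
    else d
  | .propose =>
    { d with
      parent := (d.plan X C r).parent
      label := (d.plan X C r).dist + 1
      frag := (d.plan X C r).root
      hook := (d.plan X C r).hook
      color := (d.plan X C r).target.elim 0 (coleVishkin d.frag) }
  | .color => { d with color := r.elim (d.newColor X) (fun m => m.2.2.1) }
  | .orient =>
    { d with
      label := r.elim (d.slot X C p.palette) (fun m => m.2.2.1) * p.depth + d.label
      parent := if d.parent = none ∧ d.Attaches X C then d.hook else d.parent }
  | .relabel =>
    { d with
      label := r.elim 1 (fun m => m.2.2.1 + 1)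
      frag := r.elim d.id (fun m => m.2.2.2) }

end TreeParams

/-- The protocol that computes a spanning tree. -/
noncomputable def treeProtocol (p : ℕ → TreeParams) : StagedProtocol where
  Data := NodeData
  XMsg := NbrMsg
  UMsg := ParentMsg
  DMsg := ChildMsg
  encX := bitCode
  encU := bitCode
  encD := bitCode
  encX_injective := bitCode_injective
  encU_injective := bitCode_injective
  encD_injective := bitCode_injective
  init _ w := ⟨w.ident, w.clusterNbrs, none, 1, w.ident, none, 0⟩
  -- After `orient` the labels fill blocks of length `depth`, one for each slot from `0` to `2 *
  -- palette`.
  height n := (2 * (p n).palette + 1) * (p n).depth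
  stages n := 2 * (p n).radius + 4 * (p n).phases
  label d := d.label
  parent d := d.parent
  exch n j d := TreeParams.exch ((p n).kind j) d
  up n j d := TreeParams.up ((p n).kind j) d
  down n j d := (p n).down ((p n).kind j) d
  next n j d := (p n).next ((p n).kind j) d
  result d X := {i | d.parent = some i ∨ ∃ l q, (i, l, q, some d.id) ∈ X}

/-! ### Forests of fragments -/

section Forest

variable {V : Type} (N : ClusteredNetwork V)

/-- The node `u` is the parent of the node `v`. -/
def IsParent (s : V → NodeData) (v u : V) : Prop :=
  N.graph.Adj v u ∧ (s v).parent = some (N.ident u)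

/-- The edges between nodes and their parents. -/
def treeGraph (s : V → NodeData) : SimpleGraph V where
  Adj v u := IsParent N s v u ∨ IsParent N s u v
  symm := ⟨fun _ _ h => h.symm⟩
  loopless := ⟨fun v h => N.graph.loopless.irrefl v (h.elim And.left And.left)⟩

/-- The nodes without parent. -/
def rootSet (s : V → NodeData) : Set V := {v | (s v).parent = none}

/-- The parent pointers form trees, labels are depths, and every node knows the root of its tree. -/
structure IsForest (s : V → NodeData) : Prop where
  id : ∀ v, (s v).id = N.ident v
  root : ∀ v, (s v).parent = none → (s v).label = 1 ∧ (s v).frag = N.ident v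
  parent : ∀ v i, (s v).parent = some i → ∃ u, N.graph.Adj v u ∧ N.ident u = i ∧
    (s v).label = (s u).label + 1 ∧ (s v).frag = (s u).frag

/-- Nodes of the same cluster are joined by a path of length at most `2 * D` in the trees. -/
def Compact (D : ℕ) (s : V → NodeData) : Prop :=
  ∀ v u, N.cluster v u → ∃ w : (treeGraph N s).Walk v u, w.length ≤ 2 * D

variable {N} {s s' : V → NodeData}

/-- This is how compactness survives all phases: tree edges are reversed or added, but never given
up. -/
theorem Compact.mono {D : ℕ} (h : Compact N D s) (hle : treeGraph N s ≤ treeGraph N s') :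
    Compact N D s' := by
  intro v u hvu
  obtain ⟨w, hw⟩ := h v u hvu
  exact ⟨w.mapLe hle, by simpa using hw⟩

theorem treeGraph_eq_of_parent_eq (h : ∀ v, (s' v).parent = (s v).parent) :
    treeGraph N s' = treeGraph N s := by
  ext v u
  simp [treeGraph, IsParent, h]

theorem treeGraph_le : treeGraph N s ≤ N.graph := by
  rintro v u (h | h)
  · exact h.1
  · exact h.1.symm

theorem IsParent.unique {v u u' : V} (h : IsParent N s v u) (h' : IsParent N s v u') : u = u' := by
  have := h.2.symm.trans h'.2
  exact N.ident.injective (Option.some.inj this)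

theorem IsForest.isParent_of_some (h : IsForest N s) {v : V} {i : ℕ}
    (hi : (s v).parent = some i) : ∃ u, IsParent N s v u ∧ N.ident u = i := by
  obtain ⟨u, ha, rfl, -⟩ := h.parent v i hi
  exact ⟨u, ⟨ha, hi⟩, rfl⟩

theorem IsForest.label_eq (h : IsForest N s) {v u : V} (hvu : IsParent N s v u) :
    (s v).label = (s u).label + 1 := by
  obtain ⟨u', ha, hu, hl, -⟩ := h.parent v _ hvu.2
  rwa [N.ident.injective hu] at hl

theorem IsForest.frag_eq (h : IsForest N s) {v u : V} (hvu : IsParent N s v u) :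
    (s v).frag = (s u).frag := by
  obtain ⟨u', ha, hu, -, hl⟩ := h.parent v _ hvu.2
  rwa [N.ident.injective hu] at hl

theorem IsForest.induction (h : IsForest N s) {Q : V → Prop}
    (root : ∀ v, (s v).parent = none → Q v)
    (parent : ∀ v u, IsParent N s v u → Q u → Q v) (v : V) : Q v := by
  induction hl : (s v).label using Nat.strong_induction_on generalizing v with
  | _ l ih =>
    rcases hp : (s v).parent with _ | i
    · exact root v hp
    · obtain ⟨u, hu, -⟩ := h.isParent_of_some hp
      have := h.label_eq hu
      exact parent v u hu (ih _ (by omega) u rfl)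

theorem IsForest.exists_root (h : IsForest N s) (v : V) :
    ∃ w, (s w).parent = none ∧ Relation.ReflTransGen (IsParent N s) v w := by
  induction v using h.induction with
  | root v hv => exact ⟨v, hv, .refl⟩
  | parent v u hvu ih =>
    obtain ⟨w, hw, hp⟩ := ih
    exact ⟨w, hw, .head hvu hp⟩

theorem eq_of_reflTransGen {α : Type} (f : V → α) (hf : ∀ v u, IsParent N s v u → f v = f u)
    {v w : V} (h : Relation.ReflTransGen (IsParent N s) v w) : f v = f w := by
  induction h with
  | refl => rfl
  | tail _ h ih => rw [ih, hf _ _ h]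

theorem IsForest.frag_eq_of_reflTransGen (h : IsForest N s) {v w : V} (hw : (s w).parent = none)
    (hvw : Relation.ReflTransGen (IsParent N s) v w) : (s v).frag = N.ident w := by
  rw [← (h.root w hw).2]
  exact eq_of_reflTransGen (fun v => (s v).frag) (fun _ _ => h.frag_eq) hvw

/-- A quantity that is constant along the edges of the trees is constant on fragments. -/
theorem IsForest.eq_of_frag_eq (h : IsForest N s) {α : Type} (f : V → α)
    (hf : ∀ v u, IsParent N s v u → f v = f u) {v u : V} (hvu : (s v).frag = (s u).frag) :
    f v = f u := by
  obtain ⟨w, hw, hvw⟩ := h.exists_root v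
  obtain ⟨w', hw', huw⟩ := h.exists_root u
  have : w = w' := by
    apply N.ident.injective
    rw [← h.frag_eq_of_reflTransGen hw hvw, ← h.frag_eq_of_reflTransGen hw' huw, hvu]
  rw [eq_of_reflTransGen f hf hvw, eq_of_reflTransGen f hf huw, this]

theorem IsForest.label_pos (h : IsForest N s) (v : V) : 1 ≤ (s v).label := by
  induction v using h.induction with
  | root v hv => rw [(h.root v hv).1]
  | parent v u hvu _ =>
    rw [h.label_eq hvu]
    omega

/-- The ancestors of `v` take all labels from that of `v` down to `1`. -/
theorem IsForest.exists_label_eq (h : IsForest N s) (v : V) :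
    ∀ l, 1 ≤ l → l ≤ (s v).label → ∃ u, (s u).label = l := by
  induction v using h.induction with
  | root v hv =>
    intro l h1 h2
    rw [(h.root v hv).1] at h2
    exact ⟨v, by rw [(h.root v hv).1]; omega⟩
  | parent v u hvu ih =>
    intro l h1 h2
    rcases Nat.lt_or_eq_of_le h2 with h3 | h3
    · exact ih l h1 (by rw [h.label_eq hvu] at h3; omega)
    · exact ⟨v, h3.symm⟩

/-- Labels change by exactly one along every tree edge. -/
theorem IsForest.label_le_of_walk (h : IsForest N s) {v u : V} (w : (treeGraph N s).Walk v u) :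
    (s v).label ≤ (s u).label + w.length := by
  induction w with
  | nil => simp
  | cons ha _ ih =>
    rw [SimpleGraph.Walk.length_cons]
    rcases ha with ha | ha
    · have := h.label_eq ha
      omega
    · have := h.label_eq ha
      omega

/-- If there are few clusters, then the trees have small depth. -/
theorem IsForest.label_le [Finite V] (h : IsForest N s) {D M : ℕ} (hD : Compact N D s)
    (hM : N.cluster.classes.ncard ≤ M) (v : V) : (s v).label ≤ M * (2 * D + 1) := by
  by_contra hc
  -- These are `M + 1` nodes whose labels differ pairwise by at least `2 * D + 1`. Two of them in
  -- one cluster would be joined by a tree walk of length at most `2 * D`, so they lie in `M + 1`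
  -- different clusters.
  have hex : ∀ i : Fin (M + 1), ∃ u, (s u).label = 1 + i * (2 * D + 1) := by
    intro i
    refine h.exists_label_eq v _ (by omega) ?_
    have : (i : ℕ) * (2 * D + 1) ≤ M * (2 * D + 1) :=
      Nat.mul_le_mul_right _ (by omega)
    omega
  choose f hf using hex
  have := N.card_le_ncard_classes f (by
    have key : ∀ i j : Fin (M + 1), N.cluster (f i) (f j) → ¬ j < i := by
      intro i j hij hlt
      obtain ⟨w, hw⟩ := hD _ _ hij
      have h1 := h.label_le_of_walk w
      rw [hf, hf] at h1
      have : ((j : ℕ) + 1) * (2 * D + 1) ≤ i * (2 * D + 1) :=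
        Nat.mul_le_mul_right _ (by exact_mod_cast hlt)
      rw [add_mul, one_mul] at this
      omega
    intro i j hij
    exact le_antisymm (not_lt.1 (key i j hij)) (not_lt.1 (key j i (N.cluster.symm' hij))))
  rw [Nat.card_eq_fintype_card, Fintype.card_fin] at this
  omega

end Forest

/-! ### Rerooting the trees at the chosen edges -/

section Transitions

variable {V : Type} (N : ClusteredNetwork V)

/-- The messages that `v` receives from its neighbours in a stage of kind `k`. -/
def nbrMsgs (k : StageKind) (s : V → NodeData) (v : V) : Set (ℕ × ℕ × NbrMsg) :=
  {x | ∃ u, N.graph.Adj v u ∧ x = (N.ident u, (s u).label, TreeParams.exch k (s u))}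

/-- The effect of a stage of kind `k`. -/
structure KindTransition (q : TreeParams) (k : StageKind) (s s' : V → NodeData)
    (C : V → Set (ℕ × ParentMsg)) (r : V → Option ChildMsg) : Prop where
  child : ∀ v x, x ∈ C v ↔ ∃ u, IsParent N s u v ∧
    x = (N.ident u, TreeParams.up k (s u) (nbrMsgs N k s u) (C u))
  root : ∀ v, (s v).parent = none → r v = none
  parent : ∀ v u, IsParent N s v u → r v = some (q.down k (s u) (nbrMsgs N k s u) (C u) (r u))
  next : ∀ v, s' v = q.next k (s v) (nbrMsgs N k s v) (C v) (r v)

variable {N}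

theorem kindTransition_of_transition {p : ℕ → TreeParams} {n j : ℕ} {s s' : V → NodeData}
    {C : V → Set (ℕ × ParentMsg)} {r : V → Option ChildMsg}
    (h : (treeProtocol p).Transition N n j s s' C r) :
    KindTransition N (p n) ((p n).kind j) s s' C r where
  child v x := by
    rw [h.child v]
    constructor
    · rintro ⟨u, h1, h2, h3⟩
      exact ⟨u, ⟨h1.symm, h2⟩, h3⟩
    · rintro ⟨u, ⟨h1, h2⟩, h3⟩
      exact ⟨u, h1.symm, h2, h3⟩
  root := h.root
  parent v u hvu := h.parent v u hvu.1 hvu.2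
  next := h.next

theorem NodeData.offer_eq_some {d : NodeData} {X : Set (ℕ × ℕ × NbrMsg)} {C : Set (ℕ × ParentMsg)}
    {o : Offer} (h : d.offer X C = some o) : d.IsOffer X C o := by
  unfold NodeData.offer at h
  split_ifs at h with hex
  rw [← Option.some.inj h]
  exact hex.choose_spec

theorem NodeData.offer_eq_none {d : NodeData} {X : Set (ℕ × ℕ × NbrMsg)} {C : Set (ℕ × ParentMsg)}
    (h : d.offer X C = none) (o : Offer) : ¬ d.IsOffer X C o := by
  unfold NodeData.offer at h
  split_ifs at h with hex
  exact fun ho => hex ⟨o, ho⟩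

variable {q : TreeParams} {s s' : V → NodeData} {C : V → Set (ℕ × ParentMsg)}
  {r : V → Option ChildMsg}

theorem plan_of_root {v : V} (hs : KindTransition N q .propose s s' C r)
    (hv : (s v).parent = none) :
    (s v).plan (nbrMsgs N .propose s v) (C v) (r v) =
      (s v).pathPlan (nbrMsgs N .propose s v) (C v) := by
  rw [hs.root v hv]
  rfl

theorem plan_of_isParent {v u : V} (hf : IsForest N s)
    (hs : KindTransition N q .propose s s' C r) (hvu : IsParent N s v u) :
    (s v).plan (nbrMsgs N .propose s v) (C v) (r v) =
      if ((s u).plan (nbrMsgs N .propose s u) (C u) (r u)).child = some (N.ident v) then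
        (s v).pathPlan (nbrMsgs N .propose s v) (C v)
      else ⟨((s u).plan (nbrMsgs N .propose s u) (C u) (r u)).target, none,
        ((s u).plan (nbrMsgs N .propose s u) (C u) (r u)).dist + 1,
        ((s u).plan (nbrMsgs N .propose s u) (C u) (r u)).root, (s v).parent, none⟩ := by
  rw [hs.parent v u hvu, ← hf.id v]
  rfl

/-- A root, or a node named by its parent as the next one on the path to the chosen edge, acts on
its own offer. Any other node keeps its parent and inherits target and new root from it, one step
farther away. -/
theorem plan_cases (hf : IsForest N s) (hs : KindTransition N q .propose s s' C r) (v : V) :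
    ((s v).plan (nbrMsgs N .propose s v) (C v) (r v) =
      (s v).pathPlan (nbrMsgs N .propose s v) (C v)) ∨
    ∃ u, IsParent N s v u ∧
      ((s u).plan (nbrMsgs N .propose s u) (C u) (r u)).child ≠ some (N.ident v) ∧
      (s v).plan (nbrMsgs N .propose s v) (C v) (r v) =
      ⟨((s u).plan (nbrMsgs N .propose s u) (C u) (r u)).target, none,
        ((s u).plan (nbrMsgs N .propose s u) (C u) (r u)).dist + 1,
        ((s u).plan (nbrMsgs N .propose s u) (C u) (r u)).root, (s v).parent, none⟩ := by
  rcases hp : (s v).parent with _ | i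
  · exact Or.inl (plan_of_root hs hp)
  · obtain ⟨u, hu, -⟩ := hf.isParent_of_some hp
    by_cases hc : ((s u).plan (nbrMsgs N .propose s u) (C u) (r u)).child = some (N.ident v)
    · left
      rw [plan_of_isParent hf hs hu, if_pos hc]
    · right
      refine ⟨u, hu, hc, ?_⟩
      rw [plan_of_isParent hf hs hu, if_neg hc, hp]

theorem offer_of_mem_child {v : V} {i k a b : ℕ} (hs : KindTransition N q .propose s s' C r)
    (h : (i, some (k, a, b)) ∈ C v) : ∃ c o, IsParent N s c v ∧ N.ident c = i ∧
      (s c).offer (nbrMsgs N .propose s c) (C c) = some o ∧ o.dist = k ∧ o.target = a ∧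
      o.root = b := by
  obtain ⟨c, hc, hx⟩ := (hs.child v _).1 h
  rw [Prod.mk.injEq] at hx
  obtain ⟨h1, h2⟩ := hx
  obtain ⟨o, ho, hx⟩ := Option.map_eq_some_iff.1 h2.symm
  simp only [Prod.mk.injEq] at hx
  exact ⟨c, o, hc, h1.symm, ho, hx⟩

/-- The next node of the path to the chosen edge. -/
theorem plan_child {v : V} {i : ℕ} (hf : IsForest N s)
    (hs : KindTransition N q .propose s s' C r)
    (h : ((s v).plan (nbrMsgs N .propose s v) (C v) (r v)).child = some i) :
    ∃ c, IsParent N s c v ∧ N.ident c = i ∧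
      (s v).plan (nbrMsgs N .propose s v) (C v) (r v) =
        ⟨((s c).plan (nbrMsgs N .propose s c) (C c) (r c)).target, some i,
        ((s c).plan (nbrMsgs N .propose s c) (C c) (r c)).dist + 1,
        ((s c).plan (nbrMsgs N .propose s c) (C c) (r c)).root, some i, none⟩ := by
  rcases plan_cases hf hs v with e | ⟨u, -, -, e⟩
  · rw [e] at h ⊢
    rcases ho : (s v).offer (nbrMsgs N .propose s v) (C v) with _ | o
    · simp [NodeData.pathPlan, ho] at h
    · simp only [NodeData.pathPlan, ho] at h ⊢
      rcases NodeData.offer_eq_some ho with ⟨_, _, _, -, -, -, -, hc, -⟩ | ⟨i', k, h1, h2, h3, h4⟩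
      · rw [h] at hc
        exact absurd hc (by simp)
      · obtain ⟨c, o', hcv, hci, ho', rfl, hh1, hh2⟩ := offer_of_mem_child hs h1
        have hi : i' = i := by
          rw [h3] at h
          exact Option.some.inj h
        subst hi
        refine ⟨c, hcv, hci, ?_⟩
        -- The child is named in the message of `v`, so it follows its own offer, and that is the
        -- very offer that `v` adopted. Hence the plans along the path describe the same edge.
        have hcp := plan_of_isParent hf hs hcv
        rw [e, if_pos (by rw [NodeData.pathPlan, ho, hci]; exact h)] at hcp
        rw [hcp, NodeData.pathPlan, ho']
        simp [h2, h3, h4, hh1, hh2]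
  · rw [e] at h
    exact absurd h (by simp)

/-- The two cases for an edge of the old trees. -/
theorem plan_edge {v u : V} (hf : IsForest N s) (hs : KindTransition N q .propose s s' C r)
    (hvu : IsParent N s v u) :
    ((s v).plan (nbrMsgs N .propose s v) (C v) (r v)).target =
      ((s u).plan (nbrMsgs N .propose s u) (C u) (r u)).target ∧
    ((s v).plan (nbrMsgs N .propose s v) (C v) (r v)).root =
      ((s u).plan (nbrMsgs N .propose s u) (C u) (r u)).root ∧
    (((s u).plan (nbrMsgs N .propose s u) (C u) (r u)).parent = some (N.ident v) ∨
      ((s v).plan (nbrMsgs N .propose s v) (C v) (r v)).parent = some (N.ident u)) := by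
  by_cases h : ((s u).plan (nbrMsgs N .propose s u) (C u) (r u)).child = some (N.ident v)
  · obtain ⟨c, -, hci, e⟩ := plan_child hf hs h
    rw [N.ident.injective hci] at e
    simp [e]
  · rw [plan_of_isParent hf hs hvu, if_neg h]
    exact ⟨rfl, rfl, Or.inr hvu.2⟩

/-- Nodes with a new parent. -/
theorem plan_parent {v : V} {i : ℕ} (hf : IsForest N s)
    (hs : KindTransition N q .propose s s' C r)
    (h : ((s v).plan (nbrMsgs N .propose s v) (C v) (r v)).parent = some i) :
    ∃ u, (IsParent N s v u ∨ IsParent N s u v) ∧ N.ident u = i ∧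
      ((s v).plan (nbrMsgs N .propose s v) (C v) (r v)).dist =
        ((s u).plan (nbrMsgs N .propose s u) (C u) (r u)).dist + 1 ∧
      ((s v).plan (nbrMsgs N .propose s v) (C v) (r v)).target =
        ((s u).plan (nbrMsgs N .propose s u) (C u) (r u)).target ∧
      ((s v).plan (nbrMsgs N .propose s v) (C v) (r v)).root =
        ((s u).plan (nbrMsgs N .propose s u) (C u) (r u)).root ∧
      ((s v).plan (nbrMsgs N .propose s v) (C v) (r v)).hook = none := by
  rcases plan_cases hf hs v with e | ⟨u, hu, hc, e⟩
  · have hch : ((s v).plan (nbrMsgs N .propose s v) (C v) (r v)).child = some i := by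
      rw [← h, e]
      unfold NodeData.pathPlan
      split <;> rfl
    obtain ⟨c, hc, hci, e⟩ := plan_child hf hs hch
    rw [e]
    exact ⟨c, Or.inr hc, hci, rfl, rfl, rfl, rfl⟩
  · rw [e] at h ⊢
    refine ⟨u, Or.inl hu, ?_, rfl, rfl, rfl, rfl⟩
    rw [hu.2] at h
    exact Option.some.inj h

/-- Nodes without new parent. -/
theorem plan_root {v : V} (hf : IsForest N s) (hs : KindTransition N q .propose s s' C r)
    (h : ((s v).plan (nbrMsgs N .propose s v) (C v) (r v)).parent = none) :
    ((s v).plan (nbrMsgs N .propose s v) (C v) (r v)).dist = 0 ∧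
    ((s v).plan (nbrMsgs N .propose s v) (C v) (r v)).root = N.ident v ∧
    ((((s v).plan (nbrMsgs N .propose s v) (C v) (r v)).target = none ∧
      ((s v).plan (nbrMsgs N .propose s v) (C v) (r v)).hook = none) ∨
    ∃ u, N.graph.Adj v u ∧ (s u).frag ≠ (s v).frag ∧
      ((s v).plan (nbrMsgs N .propose s v) (C v) (r v)).target = some (s u).frag ∧
      ((s v).plan (nbrMsgs N .propose s v) (C v) (r v)).hook = some (N.ident u)) := by
  rcases plan_cases hf hs v with e | ⟨u, hu, hc, e⟩
  · rw [e] at h ⊢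
    rcases ho : (s v).offer (nbrMsgs N .propose s v) (C v) with _ | o
    · simp [NodeData.pathPlan, ho, hf.id v]
    · simp only [NodeData.pathPlan, ho] at h ⊢
      rcases NodeData.offer_eq_some ho with ⟨i, l, y, hx, h1, h2, h3, h4, h5⟩ | ⟨i', k, h1, h2, h3, h4⟩
      · obtain ⟨u, ha, hu⟩ := hx
        simp only [Prod.mk.injEq, TreeParams.exch] at hu
        refine ⟨h2, h3.trans (hf.id v), Or.inr ⟨u, ha, ?_, ?_, ?_⟩⟩
        · rw [← hu.2.2.1]
          exact h1
        · rw [hu.2.2.1]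
        · rw [h5, hu.1]
      · rw [h3] at h
        exact absurd h (by simp)
  · rw [e] at h
    exact absurd (hu.2.symm.trans h) (by simp)

end Transitions

/-! ### Choosing outgoing edges and colouring the trees -/

section Phases

variable {V : Type} {N : ClusteredNetwork V}

/-- A forest in which the roots may have chosen edges to other trees, and in which the trees have
colours. -/
structure IsHooked (N : ClusteredNetwork V) (s : V → NodeData) : Prop where
  forest : IsForest N s
  hook : ∀ v i, (s v).hook = some i →
    (s v).parent = none ∧ ∃ u, N.graph.Adj v u ∧ N.ident u = i
  color : ∀ v u, IsParent N s v u → (s v).color = (s u).color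

/-- Every root has chosen an edge, to a tree of a different colour. -/
def AllHooked (N : ClusteredNetwork V) (s : V → NodeData) : Prop :=
  ∀ v, (s v).parent = none →
    ∃ u, N.graph.Adj v u ∧ (s v).hook = some (N.ident u) ∧ (s v).color ≠ (s u).color

/-- The parents have smaller labels. -/
structure IsOriented (N : ClusteredNetwork V) (s : V → NodeData) : Prop where
  id : ∀ v, (s v).id = N.ident v
  pos : ∀ v, 1 ≤ (s v).label
  parent : ∀ v i, (s v).parent = some i →
    ∃ u, N.graph.Adj v u ∧ N.ident u = i ∧ (s u).label < (s v).label

variable {q : TreeParams} {s s' : V → NodeData} {C : V → Set (ℕ × ParentMsg)}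
  {r : V → Option ChildMsg}

theorem IsForest.exists_frag_eq (h : IsForest N s) (v : V) : ∃ w, (s v).frag = N.ident w := by
  obtain ⟨w, hw, hvw⟩ := h.exists_root v
  exact ⟨w, h.frag_eq_of_reflTransGen hw hvw⟩

theorem IsForest.isOriented (h : IsForest N s) : IsOriented N s where
  id := h.id
  pos := h.label_pos
  parent v i hi := by
    obtain ⟨u, ha, hu, hl, -⟩ := h.parent v i hi
    exact ⟨u, ha, hu, by omega⟩

/-! #### Choosing edges -/

/-- The path from the old root to the chosen edge is reversed, and `dist` counts the steps to the
new root, so `dist + 1` is the new depth label. -/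
theorem isForest_propose (hf : IsForest N s) (hs : KindTransition N q .propose s s' C r) :
    IsForest N s' where
  id v := by
    rw [hs.next v]
    exact hf.id v
  root v hv := by
    rw [hs.next v] at hv ⊢
    obtain ⟨h1, h2, -⟩ := plan_root hf hs hv
    simp [TreeParams.next, h1, h2]
  parent v i hv := by
    rw [hs.next v] at hv
    obtain ⟨u, h1, h2, h3, h4, h5, h6⟩ := plan_parent hf hs hv
    refine ⟨u, h1.elim And.left fun h => h.1.symm, h2, ?_⟩
    simp only [hs.next, TreeParams.next, h3, h5]
    exact ⟨trivial, trivial⟩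

theorem isHooked_propose (hf : IsForest N s) (hs : KindTransition N q .propose s s' C r) :
    IsHooked N s' where
  forest := isForest_propose hf hs
  hook v i hv := by
    rw [hs.next v] at hv ⊢
    change ((s v).plan (nbrMsgs N .propose s v) (C v) (r v)).hook = some i at hv
    change ((s v).plan (nbrMsgs N .propose s v) (C v) (r v)).parent = none ∧ _
    rcases hp : ((s v).plan (nbrMsgs N .propose s v) (C v) (r v)).parent with _ | j
    · refine ⟨rfl, ?_⟩
      obtain ⟨-, -, ⟨-, h⟩ | ⟨u, ha, -, -, h⟩⟩ := plan_root hf hs hp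
      · rw [h] at hv
        exact absurd hv (by simp)
      · rw [h] at hv
        exact ⟨u, ha, Option.some.inj hv⟩
    · obtain ⟨u, -, -, -, -, -, h⟩ := plan_parent hf hs hp
      rw [h] at hv
      exact absurd hv (by simp)
  color v u hvu := by
    have hp := hvu.2
    rw [hs.next v] at hp
    obtain ⟨u', h1, h2, h3, h4, h5, h6⟩ := plan_parent hf hs hp
    obtain rfl := N.ident.injective h2
    have : (s v).frag = (s u').frag := h1.elim hf.frag_eq fun h => (hf.frag_eq h).symm
    simp only [hs.next, TreeParams.next, h4, this]

theorem treeGraph_le_propose (hf : IsForest N s) (hs : KindTransition N q .propose s s' C r) :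
    treeGraph N s ≤ treeGraph N s' := by
  have key : ∀ v u, IsParent N s v u → (treeGraph N s').Adj v u := by
    intro v u hvu
    rcases (plan_edge hf hs hvu).2.2 with h | h
    · refine Or.inr ⟨hvu.1.symm, ?_⟩
      rw [hs.next u]
      exact h
    · refine Or.inl ⟨hvu.1, ?_⟩
      rw [hs.next v]
      exact h
  rintro v u (h | h)
  · exact key v u h
  · exact (key u v h).symm

/-- The `root` entry of the plans is constant on each old tree, and a new root carries its own
identifier there. So the old root above a new root determines it. -/
theorem ncard_rootSet_propose_le [Finite V] (hf : IsForest N s)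
    (hs : KindTransition N q .propose s s' C r) : (rootSet s').ncard ≤ (rootSet s).ncard := by
  choose f hf1 hf2 using hf.exists_root
  refine Set.ncard_le_ncard_of_injOn f (fun v _ => hf1 v) ?_ (Set.toFinite _)
  have hfrag : ∀ v, (s v).frag = N.ident (f v) := fun v =>
    hf.frag_eq_of_reflTransGen (hf1 v) (hf2 v)
  intro v hv w hw hvw
  have h := hf.eq_of_frag_eq
    (fun v => ((s v).plan (nbrMsgs N .propose s v) (C v) (r v)).root)
    (fun v u hvu => (plan_edge hf hs hvu).2.1)
    (v := v) (u := w) (by rw [hfrag, hfrag, hvw])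
  change (s' v).parent = none at hv
  change (s' w).parent = none at hw
  rw [hs.next] at hv hw
  simp only [(plan_root hf hs hv).2.1, (plan_root hf hs hw).2.1] at h
  exact N.ident.injective h

/-- If some tree has not found an edge to another tree, then there is only one tree. -/
theorem ncard_rootSet_le_one [Finite V] (hG : N.graph.Connected) (hf : IsForest N s)
    (hs : KindTransition N q .propose s s' C r) {v : V}
    (hv : ((s v).plan (nbrMsgs N .propose s v) (C v) (r v)).target = none) :
    (rootSet s).ncard ≤ 1 := by
  obtain ⟨w, hw, hvw⟩ := hf.exists_root v
  have hwt : ((s w).plan (nbrMsgs N .propose s w) (C w) (r w)).target = none := by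
    rw [← hv]
    exact (eq_of_reflTransGen (fun v => ((s v).plan (nbrMsgs N .propose s v) (C v) (r v)).target)
      (fun v u hvu => (plan_edge hf hs hvu).1) hvw).symm
  have hwo : (s w).offer (nbrMsgs N .propose s w) (C w) = none := by
    rw [plan_of_root hs hw] at hwt
    rcases ho : (s w).offer (nbrMsgs N .propose s w) (C w) with _ | o
    · rfl
    · simp [NodeData.pathPlan, ho] at hwt
  -- Every offer gives its parent something to offer. If the root has nothing to offer, then no node
  -- of its tree has.
  have hoff : ∀ x, (s x).frag = N.ident w →
      (s x).offer (nbrMsgs N .propose s x) (C x) = none := by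
    intro x
    induction x using hf.induction with
    | root x hx =>
      intro h
      rw [(hf.root x hx).2] at h
      rwa [N.ident.injective h]
    | parent x u hxu ih =>
      intro h
      have hu := ih ((hf.frag_eq hxu).symm.trans h)
      rcases ho : (s x).offer (nbrMsgs N .propose s x) (C x) with _ | o
      · rfl
      · refine absurd (Or.inr ⟨N.ident x, o.dist, ?_, rfl, rfl, rfl⟩)
          (NodeData.offer_eq_none hu ⟨o.dist + 1, o.target, o.root, some (N.ident x), none⟩)
        refine (hs.child u _).2 ⟨x, hxu, ?_⟩
        simp [TreeParams.up, ho]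
  -- No offers means that no edge leaves the tree, so a walk starting in it stays in it; by
  -- connectedness it contains all nodes.
  have hwalk : ∀ x y, N.graph.Walk x y → (s x).frag = N.ident w → (s y).frag = N.ident w := by
    intro x y p hx
    induction p with
    | nil => exact hx
    | @cons a b c hab p ih =>
      refine ih ?_
      by_contra hb
      exact absurd (Or.inl ⟨N.ident b, (s b).label, (s b).parent, ⟨b, hab, rfl⟩,
        fun h => hb (h.trans hx), rfl, rfl, rfl, rfl⟩) (NodeData.offer_eq_none (hoff a hx)
        ⟨0, (s b).frag, (s a).id, none, some (N.ident b)⟩)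
  have hall : ∀ x, (s x).frag = N.ident w := by
    intro x
    obtain ⟨p⟩ := hG.preconnected w x
    exact hwalk w x p (hf.root w hw).2
  rw [Set.ncard_le_one_iff_subsingleton]
  intro x hx y hy
  have h1 := hall x
  have h2 := hall y
  rw [(hf.root x hx).2] at h1
  rw [(hf.root y hy).2] at h2
  exact N.ident.injective (h1.trans h2.symm)

/-- With two or more trees every tree finds an edge. If it leads from `v` to `u`, then `v` is
coloured from its fragment and that of `u`, and `u` from its fragment and the target of that
fragment, so `coleVishkin_ne` separates them. -/
theorem allHooked_propose [Finite V] (hG : N.graph.Connected) (hf : IsForest N s)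
    (hs : KindTransition N q .propose s s' C r) (h2 : 2 ≤ (rootSet s').ncard) :
    AllHooked N s' := by
  have htarget : ∀ v, ((s v).plan (nbrMsgs N .propose s v) (C v) (r v)).target ≠ none := by
    intro v hv
    have := ncard_rootSet_le_one hG hf hs hv
    have := ncard_rootSet_propose_le hf hs
    omega
  have hne : ∀ v q, ((s v).plan (nbrMsgs N .propose s v) (C v) (r v)).target = some q →
      (s v).frag ≠ q := by
    intro v q hv
    have hf' := isForest_propose hf hs
    obtain ⟨w, hw, hvw⟩ := hf'.exists_root v
    have hedge : ∀ v u, IsParent N s' v u → (s v).frag = (s u).frag ∧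
        ((s v).plan (nbrMsgs N .propose s v) (C v) (r v)).target =
        ((s u).plan (nbrMsgs N .propose s u) (C u) (r u)).target := by
      intro v u hvu
      have hp := hvu.2
      rw [hs.next v] at hp
      obtain ⟨u', h1, h2, h3, h4, h5, h6⟩ := plan_parent hf hs hp
      obtain rfl := N.ident.injective h2
      exact ⟨h1.elim hf.frag_eq fun h => (hf.frag_eq h).symm, h4⟩
    have e1 := eq_of_reflTransGen (fun v => (s v).frag) (fun v u h => (hedge v u h).1) hvw
    have e2 := eq_of_reflTransGen
      (fun v => ((s v).plan (nbrMsgs N .propose s v) (C v) (r v)).target)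
      (fun v u h => (hedge v u h).2) hvw
    rw [hv] at e2
    rw [hs.next w] at hw
    obtain ⟨-, -, ⟨h, -⟩ | ⟨u, -, h1, h2, -⟩⟩ := plan_root hf hs hw
    · exact absurd h (htarget w)
    · rw [h2, Option.some.injEq] at e2
      rw [e1, e2]
      exact h1.symm
  intro v hv
  rw [hs.next v] at hv
  obtain ⟨-, -, ⟨h, -⟩ | ⟨u, ha, h1, h2, h3⟩⟩ := plan_root hf hs hv
  · exact absurd h (htarget v)
  · refine ⟨u, ha, by rw [hs.next v]; exact h3, ?_⟩
    rcases h4 : ((s u).plan (nbrMsgs N .propose s u) (C u) (r u)).target with _ | x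
    · exact absurd h4 (htarget u)
    · simp only [hs.next, TreeParams.next, h2, h4, Option.elim_some]
      exact coleVishkin_ne h1.symm

/-! #### Second colours -/

theorem hookColor_eq {k : StageKind} (hk : ∀ d, (TreeParams.exch k d).1 = d.color) {v u : V}
    (ha : N.graph.Adj v u) (hv : (s v).hook = some (N.ident u)) :
    (s v).hookColor (nbrMsgs N k s v) = (s u).color := by
  have : {c | ∃ i l h, (s v).hook = some i ∧ (i, l, c, h) ∈ nbrMsgs N k s v} = {(s u).color} := by
    ext c
    simp only [nbrMsgs, Set.mem_ofPred_eq, hv, Set.mem_singleton_iff]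
    constructor
    · rintro ⟨i, l, h, hi, w, -, hw⟩
      rw [Option.some.injEq] at hi
      subst hi
      rw [Prod.mk.injEq, Prod.mk.injEq] at hw
      rw [N.ident.injective hw.1, ← hk, ← hw.2.2]
    · rintro rfl
      refine ⟨_, (s u).label, (TreeParams.exch k (s u)).2, rfl, u, ha, ?_⟩
      rw [← hk]
  rw [NodeData.hookColor, this, csInf_singleton]

theorem color_root (hs : KindTransition N q .color s s' C r) {v : V} (hv : (s v).parent = none) :
    (s' v).color = (s v).newColor (nbrMsgs N .color s v) := by
  rw [hs.next v, hs.root v hv]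
  rfl

theorem color_parent (hs : KindTransition N q .color s s' C r) {v u : V} (h : IsParent N s v u) :
    (s' v).color = (s' u).color := by
  rw [hs.next v, hs.parent v u h, hs.next u]
  rfl

theorem isHooked_color (hh : IsHooked N s) (hs : KindTransition N q .color s s' C r) :
    IsHooked N s' where
  forest :=
    { id := fun v => by
        rw [hs.next v]
        exact hh.forest.id v
      root := fun v hv => by
        rw [hs.next v] at hv ⊢
        exact hh.forest.root v hv
      parent := fun v i hv => by
        simp only [hs.next] at hv ⊢
        exact hh.forest.parent v i hv }
  hook v i hv := by
    simp only [hs.next] at hv ⊢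
    exact hh.hook v i hv
  color v u hvu := by
    refine color_parent hs ⟨hvu.1, ?_⟩
    rw [← hvu.2, hs.next v]
    rfl

/-- The second step is the same argument as the first, with colours in place of identifiers. The
root of the tree of `u` has chosen an edge as well, so the new colour of `u` is a Cole–Vishkin value
of its old one. -/
theorem allHooked_color (hh : IsHooked N s) (ha : AllHooked N s)
    (hs : KindTransition N q .color s s' C r) : AllHooked N s' := by
  have hroot : ∀ v, (s v).parent = none → ∃ u, N.graph.Adj v u ∧
      (s v).hook = some (N.ident u) ∧ (s v).color ≠ (s u).color ∧
      (s' v).color = coleVishkin (s v).color (s u).color := by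
    intro v hv
    obtain ⟨u, h1, h2, h3⟩ := ha v hv
    refine ⟨u, h1, h2, h3, ?_⟩
    rw [color_root hs hv, NodeData.newColor, h2]
    simp only
    rw [hookColor_eq (fun _ => rfl) h1 h2]
  intro v hv
  rw [hs.next v] at hv
  obtain ⟨u, h1, h2, h3, h4⟩ := hroot v hv
  refine ⟨u, h1, by rw [hs.next v]; exact h2, ?_⟩
  obtain ⟨w, hw, huw⟩ := hh.forest.exists_root u
  obtain ⟨x, -, -, -, h5⟩ := hroot w hw
  have e1 := eq_of_reflTransGen (fun v => (s v).color) hh.color huw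
  have e2 := eq_of_reflTransGen (fun v => (s' v).color) (fun _ _ => color_parent hs) huw
  rw [h4, e2, h5, ← e1]
  exact coleVishkin_ne h3

theorem color_lt (hh : IsHooked N s) (hs : KindTransition N q .color s s' C r) {m : ℕ}
    (hm : 1 ≤ m) (hc : ∀ v, (s v).color < 2 ^ m) (v : V) : (s' v).color < 2 * m := by
  obtain ⟨w, hw, hvw⟩ := hh.forest.exists_root v
  have e2 := eq_of_reflTransGen (fun v => (s' v).color) (fun _ _ => color_parent hs) hvw
  rw [e2, color_root hs hw, NodeData.newColor]
  rcases h : (s w).hook with _ | i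
  · simp only
    omega
  · obtain ⟨-, u, ha, rfl⟩ := hh.hook w i h
    simp only
    rw [hookColor_eq (fun _ => rfl) ha h]
    exact coleVishkin_lt hm (hc _) (hc _)

end Phases

/-! ### Attaching trees to each other -/

section Merging

variable {V : Type} {N : ClusteredNetwork V} {q : TreeParams} {s s' : V → NodeData}
  {C : V → Set (ℕ × ParentMsg)} {r : V → Option ChildMsg}

/-! #### Orientation -/

/-- A tree of larger colour has chosen an edge to a node in the subtree of `v`. -/
def HasChildTree (N : ClusteredNetwork V) (s : V → NodeData) (C : V → Set (ℕ × ParentMsg))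
    (v : V) : Prop :=
  (∃ i l c, (i, l, c, some (s v).id) ∈ nbrMsgs N .orient s v ∧ (s v).color < c) ∨
    ∃ i x, (i, some x) ∈ C v

theorem up_orient (v : V) : TreeParams.up .orient (s v) (nbrMsgs N .orient s v) (C v) ≠ none ↔
    HasChildTree N s C v := by
  by_cases h : HasChildTree N s C v
  · have h' := h
    unfold HasChildTree at h'
    simp only [TreeParams.up, h', if_true, h]
    simp
  · have h' := h
    unfold HasChildTree at h'
    simp only [TreeParams.up, h', if_false, h]
    simp

theorem hasChildTree_parent (hs : KindTransition N q .orient s s' C r) {v u : V}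
    (hvu : IsParent N s v u) (h : HasChildTree N s C v) : HasChildTree N s C u := by
  obtain ⟨x, hx⟩ := Option.ne_none_iff_exists'.1 ((up_orient v).2 h)
  exact Or.inr ⟨N.ident v, x, (hs.child u _).2 ⟨v, hvu, by rw [hx]⟩⟩

theorem hasChildTree_of_reflTransGen (hs : KindTransition N q .orient s s' C r) {v u : V}
    (hvu : Relation.ReflTransGen (IsParent N s) v u) (h : HasChildTree N s C v) :
    HasChildTree N s C u := by
  induction hvu with
  | refl => exact h
  | tail _ h ih => exact hasChildTree_parent hs h ih

theorem hasChildTree_of_hook (hh : IsHooked N s) {v u : V} (ha : N.graph.Adj v u)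
    (hv : (s v).hook = some (N.ident u)) (hc : (s u).color < (s v).color) :
    HasChildTree N s C u := by
  refine Or.inl ⟨N.ident v, (s v).label, (s v).color, ⟨v, ha.symm, ?_⟩, hc⟩
  rw [TreeParams.exch, hv, hh.forest.id u]

/-- A report is traced down to the node where it originated. The descent ends because labels
increase towards the leaves and are bounded on a finite set of nodes. -/
theorem exists_of_hasChildTree [Finite V] (hh : IsHooked N s)
    (hs : KindTransition N q .orient s s' C r) {v : V} (h : HasChildTree N s C v) :
    ∃ u x, Relation.ReflTransGen (IsParent N s) u v ∧ N.graph.Adj u x ∧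
      (s x).hook = some (N.ident u) ∧ (s u).color < (s x).color := by
  obtain ⟨B, hB⟩ := (Set.finite_range fun v => (s v).label).bddAbove
  have hB : ∀ v, (s v).label ≤ B := fun v => hB ⟨v, rfl⟩
  induction hk : B - (s v).label using Nat.strong_induction_on generalizing v with
  | _ k ih =>
    rcases h with ⟨i, l, c, ⟨x, hx, he⟩, hc⟩ | ⟨i, x, hx⟩
    · simp only [Prod.mk.injEq, TreeParams.exch] at he
      obtain ⟨-, -, rfl, h4⟩ := he
      exact ⟨v, x, .refl, hx, by rw [← h4, hh.forest.id], hc⟩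
    · obtain ⟨c, hcv, he⟩ := (hs.child v _).1 hx
      rw [Prod.mk.injEq] at he
      have h1 := hh.forest.label_eq hcv
      have h2 := hB c
      obtain ⟨u, x, h3, h4⟩ := ih _ (by omega) ((up_orient c).1 (by rw [← he.2]; simp)) rfl
      exact ⟨u, x, h3.tail hcv, h4⟩

/-- The time slot of the tree of a node. -/
noncomputable def slotOf (N : ClusteredNetwork V) (q : TreeParams) (s : V → NodeData)
    (C : V → Set (ℕ × ParentMsg)) (r : V → Option ChildMsg) (v : V) : ℕ :=
  (r v).elim ((s v).slot (nbrMsgs N .orient s v) (C v) q.palette) (fun m => m.2.2.1)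

theorem slotOf_root (hs : KindTransition N q .orient s s' C r) {v : V}
    (hv : (s v).parent = none) :
    slotOf N q s C r v = (s v).slot (nbrMsgs N .orient s v) (C v) q.palette := by
  rw [slotOf, hs.root v hv]
  rfl

theorem slotOf_parent (hs : KindTransition N q .orient s s' C r) {v u : V}
    (h : IsParent N s v u) : slotOf N q s C r v = slotOf N q s C r u := by
  rw [slotOf, hs.parent v u h]
  rfl

theorem label_orient (hs : KindTransition N q .orient s s' C r) (v : V) :
    (s' v).label = slotOf N q s C r v * q.depth + (s v).label := by
  rw [hs.next v]
  rfl

theorem slot_le (hp : ∀ v, (s v).color < q.palette) (v : V) (X : Set (ℕ × ℕ × NbrMsg))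
    (C : Set (ℕ × ParentMsg)) : (s v).slot X C q.palette ≤ 2 * q.palette := by
  have := hp v
  unfold NodeData.slot
  split_ifs <;> omega

theorem slotOf_le (hh : IsHooked N s) (hs : KindTransition N q .orient s s' C r)
    (hp : ∀ v, (s v).color < q.palette) (v : V) : slotOf N q s C r v ≤ 2 * q.palette := by
  obtain ⟨w, hw, hvw⟩ := hh.forest.exists_root v
  rw [eq_of_reflTransGen (slotOf N q s C r) (fun _ _ => slotOf_parent hs) hvw, slotOf_root hs hw]
  exact slot_le hp _ _ _

theorem attaches_iff {v u : V} (ha : N.graph.Adj v u)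
    (hv : (s v).hook = some (N.ident u)) :
    (s v).Attaches (nbrMsgs N .orient s v) (C v) ↔ (s u).color < (s v).color ∨
      (s v).color < (s u).color ∧ ¬ HasChildTree N s C v := by
  rw [NodeData.Attaches, hookColor_eq (fun _ => rfl) ha hv, HasChildTree, not_or, hv]
  simp

/-- A tree that becomes part of another one has a later time slot than this one. -/
theorem slotOf_lt (hh : IsHooked N s) (hs : KindTransition N q .orient s s' C r)
    (hp : ∀ v, (s v).color < q.palette) {v u : V} (ha : N.graph.Adj v u)
    (hv : (s v).hook = some (N.ident u))
    (hat : (s v).Attaches (nbrMsgs N .orient s v) (C v)) :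
    slotOf N q s C r u < slotOf N q s C r v := by
  obtain ⟨w, hw, huw⟩ := hh.forest.exists_root u
  have hc : (s u).color = (s w).color := eq_of_reflTransGen (fun v => (s v).color) hh.color huw
  have hv0 := (hh.hook v _ hv).1
  have hpv := hp v
  have hpu := hp u
  rw [eq_of_reflTransGen (slotOf N q s C r) (fun _ _ => slotOf_parent hs) huw, slotOf_root hs hw,
    slotOf_root hs hv0]
  have hat' := (attaches_iff ha hv).1 hat
  rcases hat' with h | ⟨h, -⟩
  -- Attaching to a smaller colour: the target has `v` as a hooked tree of larger colour, so it does
  -- not itself attach upwards. Both slots are then the colours.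
  · have h1 : HasChildTree N s C w :=
      hasChildTree_of_reflTransGen hs huw (hasChildTree_of_hook hh ha hv h)
    have h2 : (s v).slot (nbrMsgs N .orient s v) (C v) q.palette = (s v).color := by
      rw [NodeData.slot, hookColor_eq (fun _ => rfl) ha hv, if_neg]
      omega
    have h3 : (s w).slot (nbrMsgs N .orient s w) (C w) q.palette = (s w).color := by
      rw [NodeData.slot, if_neg]
      rintro ⟨⟨-, h4 | ⟨-, h5, h6⟩⟩, h7⟩
      · omega
      · exact h1.elim h5 h6
    omega
  -- Attaching to a larger colour: the slot of `v` is `2 * palette - color`. The slot of the target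
  -- is either a colour, below `palette`, or of the same form with a larger colour subtracted.
  · have h2 : (s v).slot (nbrMsgs N .orient s v) (C v) q.palette =
        2 * q.palette - (s v).color := by
      rw [NodeData.slot, hookColor_eq (fun _ => rfl) ha hv, if_pos ⟨hat, h⟩]
    rw [h2, NodeData.slot]
    split_ifs <;> omega

theorem parent_orient (hs : KindTransition N q .orient s s' C r) {v : V} {i : ℕ}
    (hv : (s v).parent = some i) : (s' v).parent = some i := by
  rw [hs.next v]
  simp [TreeParams.next, hv]

/-- Old labels lie between `1` and `q.depth`, so different slots occupy disjoint blocks of labels.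
Within a tree the order is the old one, and an attaching edge leads to an earlier block by
`slotOf_lt`. -/
theorem isOriented_orient (hh : IsHooked N s) (hs : KindTransition N q .orient s s' C r)
    (hp : ∀ v, (s v).color < q.palette) (hl : ∀ v, (s v).label ≤ q.depth) :
    IsOriented N s' where
  id v := by
    rw [hs.next v]
    exact hh.forest.id v
  pos v := by
    rw [label_orient hs]
    have := hh.forest.label_pos v
    omega
  parent v i hv := by
    rcases h : (s v).parent with _ | j
    · rw [hs.next v] at hv
      simp only [TreeParams.next, h, true_and] at hv
      split_ifs at hv with hat
      obtain ⟨-, u, ha, rfl⟩ := hh.hook v i hv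
      refine ⟨u, ha, rfl, ?_⟩
      rw [label_orient hs, label_orient hs]
      have h1 : (slotOf N q s C r u + 1) * q.depth ≤ slotOf N q s C r v * q.depth :=
        Nat.mul_le_mul_right _ (slotOf_lt hh hs hp ha hv hat.2)
      have h2 := hl u
      have h3 := hh.forest.label_pos v
      rw [add_mul, one_mul] at h1
      omega
    · have h' := parent_orient hs h
      rw [hv, Option.some.injEq] at h'
      subst h'
      obtain ⟨u, hu, rfl⟩ := hh.forest.isParent_of_some h
      refine ⟨u, hu.1, rfl, ?_⟩
      rw [label_orient hs, label_orient hs, slotOf_parent hs hu, hh.forest.label_eq hu]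
      omega

theorem label_orient_le (hh : IsHooked N s) (hs : KindTransition N q .orient s s' C r)
    (hp : ∀ v, (s v).color < q.palette) (hl : ∀ v, (s v).label ≤ q.depth) (v : V) :
    (s' v).label ≤ (2 * q.palette + 1) * q.depth := by
  rw [label_orient hs, add_mul, one_mul]
  exact Nat.add_le_add (Nat.mul_le_mul_right _ (slotOf_le hh hs hp v)) (hl v)

theorem treeGraph_le_orient (hs : KindTransition N q .orient s s' C r) :
    treeGraph N s ≤ treeGraph N s' := by
  rintro v u (h | h)
  · exact Or.inl ⟨h.1, parent_orient hs h.2⟩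
  · exact Or.inr ⟨h.1, parent_orient hs h.2⟩

theorem rootSet_orient_subset (hs : KindTransition N q .orient s s' C r) :
    rootSet s' ⊆ rootSet s := by
  intro v hv
  change (s v).parent = none
  rcases h : (s v).parent with _ | i
  · rfl
  · exact absurd ((parent_orient hs h).symm.trans hv) (by simp)

/-- The number of trees is halved. -/
theorem two_mul_ncard_rootSet_le [Finite V] (hh : IsHooked N s) (hall : AllHooked N s)
    (hs : KindTransition N q .orient s s' C r) :
    2 * (rootSet s').ncard ≤ (rootSet s).ncard := by
  have hsub := rootSet_orient_subset hs
  -- A surviving root has a smaller colour than its target and a tree of larger colour hooked to it.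
  -- That tree attaches downwards, so its root `x` disappears. The edge chosen by `x` determines the
  -- tree it leads to, so different survivors get different `x`.
  have hchoice : ∀ v ∈ rootSet s', ∃ x, x ∈ rootSet s \ rootSet s' ∧
      ∃ u, (s x).hook = some (N.ident u) ∧ Relation.ReflTransGen (IsParent N s) u v := by
    intro v hv
    have hv0 : (s v).parent = none := hsub hv
    obtain ⟨y, ha, hy, hne⟩ := hall v hv0
    have hat : ¬ (s v).Attaches (nbrMsgs N .orient s v) (C v) := by
      intro hat
      have h1 : (s' v).parent = none := hv
      rw [hs.next v] at h1
      simp [TreeParams.next, hv0, hat, hy] at h1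
    rw [attaches_iff ha hy] at hat
    have hct : HasChildTree N s C v := by
      by_contra hct
      exact hat (hne.lt_or_gt.symm.imp id fun h => ⟨h, hct⟩)
    obtain ⟨u, x, huv, hux, hx, hc⟩ := exists_of_hasChildTree hh hs hct
    have hx0 := (hh.hook x _ hx).1
    refine ⟨x, ⟨hx0, ?_⟩, u, hx, huv⟩
    intro h1
    have h1 : (s' x).parent = none := h1
    rw [hs.next x] at h1
    simp [TreeParams.next, hx0, (attaches_iff (C := C) hux.symm hx).2 (Or.inl hc), hx] at h1
  choose! f hf1 hf2 using hchoice
  have hinj : Set.InjOn f (rootSet s') := by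
    intro v hv w hw hvw
    obtain ⟨u, h1, h2⟩ := hf2 v hv
    obtain ⟨u', h3, h4⟩ := hf2 w hw
    rw [hvw, h3, Option.some.injEq] at h1
    have := N.ident.injective h1
    subst this
    apply N.ident.injective
    rw [← hh.forest.frag_eq_of_reflTransGen (hsub hv) h2,
      ← hh.forest.frag_eq_of_reflTransGen (hsub hw) h4]
  have h1 := Set.ncard_le_ncard_of_injOn f hf1 hinj (Set.toFinite _)
  have h2 := Set.ncard_sdiff_add_ncard_of_subset hsub (Set.toFinite _)
  omega

/-! #### Relabelling -/

theorem relabel_root (hs : KindTransition N q .relabel s s' C r) {v : V}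
    (hv : (s v).parent = none) : (s' v).label = 1 ∧ (s' v).frag = (s v).id := by
  rw [hs.next v, hs.root v hv]
  exact ⟨rfl, rfl⟩

theorem relabel_parent (hs : KindTransition N q .relabel s s' C r) {v u : V}
    (h : IsParent N s v u) :
    (s' v).label = (s' u).label + 1 ∧ (s' v).frag = (s' u).frag := by
  rw [hs.next v, hs.parent v u h, hs.next u]
  exact ⟨rfl, rfl⟩

/-- The broadcast still runs on the slot labels, for which only the order matters, and delivers the
true depth and the identifier of the new root. -/
theorem isForest_relabel (ho : IsOriented N s) (hs : KindTransition N q .relabel s s' C r) :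
    IsForest N s' where
  id v := by
    rw [hs.next v]
    exact ho.id v
  root v hv := by
    rw [hs.next v] at hv
    obtain ⟨h1, h2⟩ := relabel_root hs hv
    exact ⟨h1, h2.trans (ho.id v)⟩
  parent v i hv := by
    rw [hs.next v] at hv
    obtain ⟨u, ha, rfl, -⟩ := ho.parent v i hv
    exact ⟨u, ha, rfl, relabel_parent hs ⟨ha, hv⟩⟩

end Merging

/-! ### Spanning trees of the clusters -/

section Clusters

variable {V : Type} {N : ClusteredNetwork V} {q : TreeParams} {s s' : V → NodeData}
  {C : V → Set (ℕ × ParentMsg)} {r : V → Option ChildMsg}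

theorem mem_clusterNbrs {v : V} {i : ℕ} :
    i ∈ (N.view v).clusterNbrs ↔ ∃ u, N.clusterGraph.Adj v u ∧ N.ident u = i := by
  constructor
  · rintro ⟨u, h1, h2, h3⟩
    exact ⟨u, ⟨h1, h2⟩, h3⟩
  · rintro ⟨u, ⟨h1, h2⟩, h3⟩
    exact ⟨u, h1, h2, h3⟩

/-- After `j` stages every node knows the minimal identifier within distance `j`. -/
structure FloodInv (N : ClusteredNetwork V) (j : ℕ) (s : V → NodeData) : Prop where
  id : ∀ v, (s v).id = N.ident v
  mates : ∀ v, (s v).mates = (N.view v).clusterNbrs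
  parent : ∀ v, (s v).parent = none
  label : ∀ v, (s v).label = 1
  frag : ∀ v, ∃ u, N.cluster v u ∧ (s v).frag = N.ident u
  le : ∀ v u (w : N.clusterGraph.Walk v u), w.length ≤ j → (s v).frag ≤ N.ident u

theorem frag_flood (h : ∀ v, (s v).mates = (N.view v).clusterNbrs)
    (hs : KindTransition N q .flood s s' C r) (v : V) :
    (s' v).frag = sInf ({(s v).frag} ∪ {x | ∃ u, N.clusterGraph.Adj v u ∧ x = (s u).frag}) := by
  rw [hs.next v]
  simp only [TreeParams.next]
  congr 2
  ext x
  simp only [Set.mem_ofPred_eq, h v, mem_clusterNbrs, nbrMsgs, Prod.mk.injEq, TreeParams.exch]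
  constructor
  · rintro ⟨_, l, y, ⟨u, h1, rfl, h2, h3, h4⟩, u', h5, h6⟩
    rw [N.ident.injective h6] at h5
    exact ⟨u, h5, h3⟩
  · rintro ⟨u, h1, rfl⟩
    exact ⟨N.ident u, (s u).label, none, ⟨u, h1.1, rfl, rfl, rfl, rfl⟩, u, h1, rfl⟩

theorem floodInv_flood {j : ℕ} (h : FloodInv N j s) (hs : KindTransition N q .flood s s' C r) :
    FloodInv N (j + 1) s' where
  id v := by
    rw [hs.next v]
    exact h.id v
  mates v := by
    rw [hs.next v]
    exact h.mates v
  parent v := by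
    rw [hs.next v]
    exact h.parent v
  label v := by
    rw [hs.next v]
    exact h.label v
  frag v := by
    have hm := Nat.sInf_mem (s := {(s v).frag} ∪ {x | ∃ u, N.clusterGraph.Adj v u ∧ x = (s u).frag})
      ⟨_, Or.inl rfl⟩
    rw [← frag_flood h.mates hs v] at hm
    rcases hm with hm | ⟨u, hu, hm⟩
    · obtain ⟨w, hw⟩ := h.frag v
      exact ⟨w, hw.1, hm.trans hw.2⟩
    · obtain ⟨w, hw⟩ := h.frag u
      exact ⟨w, N.cluster.trans' hu.2 hw.1, hm.trans hw.2⟩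
  le v u w hw := by
    rw [frag_flood h.mates hs v]
    cases w with
    | nil => exact (Nat.sInf_le (Or.inl rfl)).trans (h.le v v .nil (by simp))
    | cons ha w =>
      rw [SimpleGraph.Walk.length_cons] at hw
      exact (Nat.sInf_le (Or.inr ⟨_, ha, rfl⟩)).trans (h.le _ _ w (by omega))

/-- After `j` stages the tree of a cluster contains all nodes within distance `j` of the node with
the minimal identifier. -/
structure GrowInv (N : ClusteredNetwork V) (j : ℕ) (s : V → NodeData) : Prop where
  id : ∀ v, (s v).id = N.ident v
  mates : ∀ v, (s v).mates = (N.view v).clusterNbrs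
  frag_eq : ∀ v u, N.cluster v u → (s v).frag = (s u).frag
  frag : ∀ v, ∃ u, N.cluster v u ∧ (s v).frag = N.ident u
  root : ∀ v, (s v).parent = none → (s v).label = 1
  parent : ∀ v i, (s v).parent = some i → ∃ u, N.clusterGraph.Adj v u ∧ N.ident u = i ∧
    (s u).Reached ∧ (s v).label = (s u).label + 1
  reached : ∀ v u (w : N.clusterGraph.Walk v u), w.length ≤ j → (s v).frag = N.ident u →
    (s v).Reached
  label : ∀ v, (s v).label ≤ j + 1

/-- Walks of length `D` reach the whole cluster, so for any two of its nodes each value is at most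
the other. Only the owner of the common minimum counts as reached at first. -/
theorem growInv_of_floodInv {D : ℕ} (h : FloodInv N D s)
    (hD : ∀ v u, N.cluster v u → ∃ w : N.clusterGraph.Walk v u, w.length ≤ D) :
    GrowInv N 0 s where
  id := h.id
  mates := h.mates
  frag_eq := by
    have key : ∀ v u, N.cluster v u → (s u).frag ≤ (s v).frag := by
      intro v u hvu
      obtain ⟨x, hx, hv⟩ := h.frag v
      obtain ⟨w, hw⟩ := hD u x (N.cluster.trans' (N.cluster.symm' hvu) hx)
      rw [hv]
      exact h.le u x w hw
    exact fun v u hvu => le_antisymm (key u v (N.cluster.symm' hvu)) (key v u hvu)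
  frag := h.frag
  root v _ := h.label v
  parent v i hi := by
    rw [h.parent v] at hi
    exact absurd hi (by simp)
  reached v u w hw hf := by
    have := SimpleGraph.Walk.eq_of_length_eq_zero (Nat.le_zero.1 hw)
    subst this
    exact Or.inr (hf.trans (h.id v).symm)
  label v := (h.label v).le

theorem next_grow (h : GrowInv N j s) (hs : KindTransition N q .grow s s' C r) (v : V) :
    (s' v = s v ∧ ((s v).Reached ∨ ∀ u, N.clusterGraph.Adj v u → ¬ (s u).Reached)) ∨
    ¬ (s v).Reached ∧ ∃ u, N.clusterGraph.Adj v u ∧ (s u).Reached ∧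
      s' v = { s v with parent := some (N.ident u), label := (s u).label + 1 } := by
  have hmem : ∀ i l y, (i, l, 1, y) ∈ nbrMsgs N .grow s v ∧ i ∈ (s v).mates ↔
      ∃ u, N.clusterGraph.Adj v u ∧ (s u).Reached ∧ i = N.ident u ∧ l = (s u).label ∧
        y = none := by
    intro i l y
    simp only [nbrMsgs, Set.mem_ofPred_eq, Prod.mk.injEq, h.mates v, mem_clusterNbrs,
      TreeParams.exch]
    constructor
    · rintro ⟨⟨u, h1, h2, h3, h4, h5⟩, u', h6, h7⟩
      rw [N.ident.injective (h7.trans h2)] at h6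
      refine ⟨u, h6, ?_, h2, h3, h5⟩
      by_contra hc
      rw [if_neg hc] at h4
      exact absurd h4 (by simp)
    · rintro ⟨u, h1, h2, rfl, rfl, rfl⟩
      exact ⟨⟨u, h1.1, rfl, rfl, by rw [if_pos h2], rfl⟩, u, h1, rfl⟩
  rw [hs.next v, TreeParams.next]
  split_ifs with hc
  · right
    refine ⟨hc.1, ?_⟩
    obtain ⟨y, hy⟩ := hc.2.choose_spec
    obtain ⟨u, h1, h2, h3, h4, -⟩ := (hmem _ _ _).1 hy
    exact ⟨u, h1, h2, by rw [h3, h4]⟩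
  · left
    refine ⟨rfl, ?_⟩
    by_contra hcon
    rw [not_or, not_forall] at hcon
    obtain ⟨h1, u, h2⟩ := hcon
    rw [Classical.not_imp, not_not] at h2
    exact hc ⟨h1, (N.ident u, (s u).label), none, (hmem _ _ _).2 ⟨u, h2.1, h2.2, rfl, rfl, rfl⟩⟩

/-- A reached node never changes again, so the label that a new node reads off its parent stays
correct. Which reached neighbour becomes the parent is immaterial. -/
theorem growInv_grow {j : ℕ} (h : GrowInv N j s) (hs : KindTransition N q .grow s s' C r) :
    GrowInv N (j + 1) s' := by
  have hn := next_grow h hs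
  have hfix : ∀ v, (s v).Reached → s' v = s v := by
    intro v hv
    rcases hn v with h1 | h1
    · exact h1.1
    · exact absurd hv h1.1
  have hfrag : ∀ v, (s' v).frag = (s v).frag := by
    intro v
    rcases hn v with ⟨h1, -⟩ | ⟨-, u, -, -, h1⟩ <;> rw [h1]
  constructor
  · intro v
    rw [← h.id v]
    rcases hn v with ⟨h1, -⟩ | ⟨-, u, -, -, h1⟩ <;> rw [h1]
  · intro v
    rw [← h.mates v]
    rcases hn v with ⟨h1, -⟩ | ⟨-, u, -, -, h1⟩ <;> rw [h1]
  · intro v u hvu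
    rw [hfrag, hfrag]
    exact h.frag_eq v u hvu
  · intro v
    rw [hfrag]
    exact h.frag v
  · intro v hv
    rcases hn v with ⟨h1, -⟩ | ⟨-, u, -, -, h1⟩
    · rw [h1] at hv ⊢
      exact h.root v hv
    · rw [h1] at hv
      exact absurd hv (by simp)
  · intro v i hv
    rcases hn v with ⟨h1, -⟩ | ⟨-, u, h2, h3, h1⟩
    · rw [h1] at hv ⊢
      obtain ⟨u, h2, h3, h4, h5⟩ := h.parent v i hv
      refine ⟨u, h2, h3, ?_⟩
      rw [hfix u h4]
      exact ⟨h4, h5⟩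
    · rw [h1] at hv ⊢
      refine ⟨u, h2, Option.some.inj hv, ?_⟩
      rw [hfix u h3]
      exact ⟨h3, rfl⟩
  · intro v u w hw hf
    rw [hfrag] at hf
    by_cases hv : (s v).Reached
    · rwa [hfix v hv]
    cases w with
    | nil => exact absurd (h.reached v v .nil (by simp) hf) hv
    | @cons _ x _ ha w =>
      rw [SimpleGraph.Walk.length_cons] at hw
      have hx := h.reached x u w (by omega) ((h.frag_eq v x ha.2).symm.trans hf)
      rcases hn v with ⟨-, h1 | h1⟩ | ⟨-, u, -, -, h1⟩
      · exact absurd h1 hv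
      · exact absurd hx (h1 x ha)
      · rw [h1]
        exact Or.inl (by simp)
  · intro v
    rcases hn v with ⟨h1, -⟩ | ⟨-, u, -, -, h1⟩
    · rw [h1]
      have := h.label v
      omega
    · rw [h1]
      have := h.label u
      simp only
      omega

/-- After `D` stages every node is reached, so a node without parent must own the identifier of its
fragment. -/
theorem isForest_of_growInv {D : ℕ} (h : GrowInv N D s)
    (hD : ∀ v u, N.cluster v u → ∃ w : N.clusterGraph.Walk v u, w.length ≤ D) :
    IsForest N s where
  id := h.id
  root v hv := by
    refine ⟨h.root v hv, ?_⟩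
    obtain ⟨u, hu, hf⟩ := h.frag v
    obtain ⟨w, hw⟩ := hD v u hu
    rcases h.reached v u w hw hf with h1 | h1
    · exact absurd hv h1
    · rw [h1, h.id v]
  parent v i hi := by
    obtain ⟨u, h1, h2, -, h3⟩ := h.parent v i hi
    exact ⟨u, h1.1, h2, h3, h.frag_eq v u h1.2⟩

/-- The path from a node to the root of its tree. -/
theorem IsForest.exists_walk_root (h : IsForest N s) (v : V) :
    ∃ u, (s u).parent = none ∧ (s v).frag = N.ident u ∧
      ∃ w : (treeGraph N s).Walk v u, w.length + 1 = (s v).label := by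
  induction v using h.induction with
  | root v hv => exact ⟨v, hv, (h.root v hv).2, .nil, by rw [(h.root v hv).1]; rfl⟩
  | parent v x hvx ih =>
    obtain ⟨u, h1, h2, w, h3⟩ := ih
    have ha : (treeGraph N s).Adj v x := Or.inl hvx
    refine ⟨u, h1, (h.frag_eq hvx).trans h2, .cons ha w, ?_⟩
    rw [SimpleGraph.Walk.length_cons, h3, h.label_eq hvx]

/-- Two nodes of the same tree are joined by a path through the root. -/
theorem IsForest.exists_walk (h : IsForest N s) {L : ℕ} (hL : ∀ v, (s v).label ≤ L + 1) {v u : V}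
    (hvu : (s v).frag = (s u).frag) :
    ∃ w : (treeGraph N s).Walk v u, w.length ≤ 2 * L := by
  obtain ⟨x, h1, h2, w, h3⟩ := h.exists_walk_root v
  obtain ⟨y, h4, h5, w', h6⟩ := h.exists_walk_root u
  have : x = y := N.ident.injective (h2.symm.trans (hvu.trans h5))
  subst this
  refine ⟨w.append w'.reverse, ?_⟩
  rw [SimpleGraph.Walk.length_append, SimpleGraph.Walk.length_reverse]
  have := hL v
  have := hL u
  omega

theorem compact_of_growInv {D : ℕ} (h : GrowInv N D s) (hf : IsForest N s) : Compact N D s :=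
  fun v u hvu => hf.exists_walk h.label (h.frag_eq v u hvu)

theorem ncard_rootSet_le_of_growInv [Finite V] {D : ℕ} (h : GrowInv N D s)
    (hf : IsForest N s) : (rootSet s).ncard ≤ N.cluster.classes.ncard := by
  rw [← Nat.card_coe_set_eq]
  refine N.card_le_ncard_classes (Subtype.val : rootSet s → V) ?_
  intro v u hvu
  have := h.frag_eq _ _ hvu
  rw [(hf.root _ v.2).2, (hf.root _ u.2).2] at this
  exact Subtype.ext (N.ident.injective this)

end Clusters

/-! ### Lengths of messages -/

theorem length_bitCode_nbrMsg {l a b : ℕ} {o : Option ℕ} (hl : l < 2 ^ b) (ha : a < 2 ^ b)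
    (ho : ∀ x, o = some x → x < 2 ^ b) :
    (bitCode ((l, a, o) : ℕ × NbrMsg)).length ≤ 8 * (b + 1) := by
  have hpow : (2 : ℕ) ^ b ≤ 2 ^ (b + 1) := Nat.pow_le_pow_right (by norm_num) (by omega)
  have hpow' : (2 : ℕ) ^ (b + 1) ≤ 2 ^ (2 * (b + 1)) :=
    Nat.pow_le_pow_right (by norm_num) (by omega)
  refine (length_bitCode_le (B := 2 * (2 * (b + 1))) ?_).trans (by omega)
  refine encode_prod_lt (hl.trans_le (hpow.trans hpow')) (encode_prod_lt (ha.trans_le hpow) ?_)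
  exact encode_option_lt ho

theorem length_bitCode_parentMsg {b : ℕ} {o : ParentMsg}
    (ho : ∀ x y z, o = some (x, y, z) → x < 2 ^ b ∧ y < 2 ^ b ∧ z < 2 ^ b) :
    (bitCode o).length ≤ 8 * (b + 1) := by
  have hpow : (2 : ℕ) ^ b ≤ 2 ^ (2 * b) := Nat.pow_le_pow_right (by norm_num) (by omega)
  refine (length_bitCode_le (B := 2 * (2 * b) + 1) ?_).trans (by omega)
  refine encode_option_lt ?_
  rintro ⟨x, y, z⟩ h
  obtain ⟨h1, h2, h3⟩ := ho x y z h
  exact encode_prod_lt (h1.trans_le hpow) (encode_prod_lt h2 h3)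

theorem length_bitCode_childMsg {b c d : ℕ} {o o' : Option ℕ} (ho : ∀ x, o = some x → x < 2 ^ b)
    (ho' : ∀ x, o' = some x → x < 2 ^ b) (hc : c < 2 ^ b) (hd : d < 2 ^ b) :
    (bitCode ((o, o', c, d) : ChildMsg)).length ≤ 8 * (b + 1) := by
  have hpow : (2 : ℕ) ^ b ≤ 2 ^ (b + 1) := Nat.pow_le_pow_right (by norm_num) (by omega)
  have hpow' : (2 : ℕ) ^ (b + 1) ≤ 2 ^ (2 * (b + 1)) :=
    Nat.pow_le_pow_right (by norm_num) (by omega)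
  have hpow'' : (2 : ℕ) ^ (2 * (b + 1)) ≤ 2 ^ (2 * (2 * (b + 1))) :=
    Nat.pow_le_pow_right (by norm_num) (by omega)
  refine (length_bitCode_le (B := 2 * (2 * (2 * (b + 1)))) ?_).trans (by omega)
  refine encode_prod_lt ((encode_option_lt ho).trans_le (hpow'.trans hpow''))
    (encode_prod_lt ((encode_option_lt ho').trans_le hpow')
      (encode_prod_lt (hc.trans_le hpow) (hd.trans_le hpow)))

/-! ### The invariant of a phase and the sizes of its messages -/

section Invariant

variable {V : Type} (N : ClusteredNetwork V)

/-- The parameters suit the network: identifiers have `m` bits, there are at most `M` clusters, and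
numbers with `b` bits suffice. -/
structure Suits (q : TreeParams) (m m' M b : ℕ) : Prop where
  connected : N.graph.Connected
  radius_pos : 1 ≤ q.radius
  walk : ∀ v u, N.cluster v u → ∃ w : N.clusterGraph.Walk v u, w.length ≤ q.radius
  bits_pos : 1 ≤ m
  ident_lt : ∀ v, N.ident v < 2 ^ m
  classes_le : N.cluster.classes.ncard ≤ M
  depth_eq : q.depth = M * (2 * q.radius + 1)
  le_pow : 2 * m ≤ 2 ^ m'
  palette_eq : q.palette = 2 * m'
  lt_pow_phases : M < 2 ^ q.phases
  le_bits : m ≤ b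
  height_lt : (2 * q.palette + 1) * q.depth < 2 ^ b

/-- The invariant in phase `i`, before a stage of kind `k`. -/
def PhaseInv (q : TreeParams) (m M i : ℕ) (k : StageKind) (s : V → NodeData) : Prop :=
  Compact N q.radius s ∧
  match k with
  | .propose => IsForest N s ∧ (rootSet s).ncard ≤ max 1 (M / 2 ^ i)
  | .color => IsHooked N s ∧ (rootSet s).ncard ≤ max 1 (M / 2 ^ i) ∧
      (2 ≤ (rootSet s).ncard → AllHooked N s) ∧ ∀ v, (s v).color < 2 * m
  | .orient => IsHooked N s ∧ (rootSet s).ncard ≤ max 1 (M / 2 ^ i) ∧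
      (2 ≤ (rootSet s).ncard → AllHooked N s) ∧ ∀ v, (s v).color < q.palette
  | .relabel => IsOriented N s ∧ (rootSet s).ncard ≤ max 1 (M / 2 ^ (i + 1)) ∧
      ∀ v, (s v).label ≤ (2 * q.palette + 1) * q.depth
  | _ => False

variable {N} {q : TreeParams} {m m' M b : ℕ} {s s' : V → NodeData}
  {C : V → Set (ℕ × ParentMsg)} {r : V → Option ChildMsg}

theorem Suits.ident_lt_pow (h : Suits N q m m' M b) (v : V) : N.ident v < 2 ^ b :=
  (h.ident_lt v).trans_le (Nat.pow_le_pow_right (by norm_num) h.le_bits)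

theorem Suits.depth_pos [Finite V] (h : Suits N q m m' M b) : q.radius + 1 ≤ q.depth := by
  obtain ⟨v⟩ := h.connected.nonempty
  have h1 := N.card_le_ncard_classes (fun _ : Unit => v) (fun _ _ _ => rfl)
  rw [Nat.card_unique] at h1
  have h2 := h.classes_le
  have h3 : 1 * (2 * q.radius + 1) ≤ M * (2 * q.radius + 1) := Nat.mul_le_mul_right _ (by omega)
  rw [h.depth_eq]
  omega

theorem Suits.depth_le : q.depth ≤ (2 * q.palette + 1) * q.depth :=
  Nat.le_mul_of_pos_left _ (by omega)

theorem Suits.palette_le [Finite V] (h : Suits N q m m' M b) :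
    2 * q.palette + 1 ≤ (2 * q.palette + 1) * q.depth :=
  Nat.le_mul_of_pos_right _ (by have := h.depth_pos; omega)

theorem Suits.two_mul_lt (h : Suits N q m m' M b) : 2 * m ≤ 2 ^ b := by
  have h1 := h.bits_pos
  have h2 : m - 1 < 2 ^ (m - 1) := Nat.lt_two_pow_self
  have h3 : 2 ^ m = 2 * 2 ^ (m - 1) := by
    rw [← pow_succ', Nat.sub_add_cancel h1]
  have h4 : (2 : ℕ) ^ m ≤ 2 ^ b := Nat.pow_le_pow_right (by norm_num) h.le_bits
  omega

theorem Suits.bits_pos' (h : Suits N q m m' M b) : 1 ≤ m' := by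
  have h1 := h.le_pow
  have h2 := h.bits_pos
  by_contra hc
  have : m' = 0 := by omega
  rw [this] at h1
  omega

theorem IsForest.frag_lt (hf : IsForest N s) (h : Suits N q m m' M b) (v : V) :
    (s v).frag < 2 ^ b := by
  obtain ⟨w, hw⟩ := hf.exists_frag_eq v
  rw [hw]
  exact h.ident_lt_pow w

theorem IsForest.label_le_depth [Finite V] (hf : IsForest N s) (h : Suits N q m m' M b)
    (hc : Compact N q.radius s) (v : V) : (s v).label ≤ q.depth := by
  rw [h.depth_eq]
  exact hf.label_le hc h.classes_le v

theorem exists_target_eq (hf : IsForest N s) (hs : KindTransition N q .propose s s' C r) {v : V}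
    {x : ℕ} (hx : ((s v).plan (nbrMsgs N .propose s v) (C v) (r v)).target = some x) :
    ∃ u, x = N.ident u := by
  obtain ⟨w, hw, hvw⟩ := (isForest_propose hf hs).exists_root v
  have e := eq_of_reflTransGen
    (fun v => ((s v).plan (nbrMsgs N .propose s v) (C v) (r v)).target)
    (fun v u hvu => by
      have hp := hvu.2
      rw [hs.next v] at hp
      obtain ⟨u', h1, h2, h3, h4, h5, h6⟩ := plan_parent hf hs hp
      rw [N.ident.injective h2] at h4
      exact h4) hvw
  rw [hs.next w] at hw
  obtain ⟨-, -, ⟨h, -⟩ | ⟨u, -, -, h2, -⟩⟩ := plan_root hf hs hw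
  · rw [h, hx] at e
    exact absurd e (by simp)
  · rw [h2, hx, Option.some.injEq] at e
    obtain ⟨y, hy⟩ := hf.exists_frag_eq u
    exact ⟨y, e.trans hy⟩

theorem color_propose_lt (h : Suits N q m m' M b) (hf : IsForest N s)
    (hs : KindTransition N q .propose s s' C r) (v : V) : (s' v).color < 2 * m := by
  have hm := h.bits_pos
  simp only [hs.next v, TreeParams.next]
  rcases hx : ((s v).plan (nbrMsgs N .propose s v) (C v) (r v)).target with _ | x
  · rw [Option.elim_none]
    omega
  · obtain ⟨u, rfl⟩ := exists_target_eq hf hs hx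
    obtain ⟨w, hw⟩ := hf.exists_frag_eq v
    rw [Option.elim_some, hw]
    exact coleVishkin_lt hm (h.ident_lt _) (h.ident_lt _)

/-- The distance of an offer plus the label of the node is the label of the endpoint of the offered
edge. The induction goes from the deepest nodes upwards. -/
theorem offer_bound (hf : IsForest N s) (hs : KindTransition N q .propose s s' C r) {L : ℕ}
    (hL : ∀ v, (s v).label ≤ L) (v : V) (o : Offer)
    (ho : (s v).offer (nbrMsgs N .propose s v) (C v) = some o) :
    o.dist + (s v).label ≤ L ∧ (∃ x, o.target = N.ident x) ∧ ∃ x, o.root = N.ident x := by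
  induction hk : L - (s v).label using Nat.strong_induction_on generalizing v o with
  | _ k ih =>
    rcases NodeData.offer_eq_some ho with ⟨i, l, y, ⟨u, -, hu⟩, -, h2, h3, -⟩ | ⟨i, k, h1, h2, -⟩
    · rw [h2, zero_add]
      simp only [Prod.mk.injEq, TreeParams.exch] at hu
      refine ⟨hL v, ?_, v, h3.trans (hf.id v)⟩
      rw [hu.2.2.1]
      exact hf.exists_frag_eq u
    · obtain ⟨c, o', hcv, -, ho', h3, h4, h5⟩ := offer_of_mem_child hs h1
      have h6 := hf.label_eq hcv
      have h7 := hL c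
      obtain ⟨h8, h9, h10⟩ := ih _ (by omega) c o' ho' rfl
      rw [← h4, ← h5]
      exact ⟨by omega, h9, h10⟩

/-- The messages of a stage have at most `B` bits. -/
structure KindShort (N : ClusteredNetwork V) (q : TreeParams) (k : StageKind) (s : V → NodeData)
    (C : V → Set (ℕ × ParentMsg)) (r : V → Option ChildMsg) (B : ℕ) : Prop where
  up : ∀ v, (bitCode (TreeParams.up k (s v) (nbrMsgs N k s v) (C v))).length ≤ B
  down : ∀ v, (bitCode (q.down k (s v) (nbrMsgs N k s v) (C v) (r v))).length ≤ B

theorem kindShort_propose [Finite V] (h : Suits N q m m' M b) (hf : IsForest N s)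
    (hc : Compact N q.radius s) (hs : KindTransition N q .propose s s' C r) :
    KindShort N q .propose s C r (8 * (b + 1)) where
  up v := by
    refine length_bitCode_parentMsg fun x y z hx => ?_
    obtain ⟨o, ho, he⟩ := Option.map_eq_some_iff.1 hx
    simp only [Prod.mk.injEq] at he
    obtain ⟨rfl, rfl, rfl⟩ := he
    obtain ⟨h1, ⟨w, h2⟩, ⟨w', h3⟩⟩ := offer_bound hf hs (hf.label_le_depth h hc) v o ho
    rw [h2, h3]
    have h4 := h.height_lt
    have h5 := Suits.depth_le (q := q)
    exact ⟨by omega, h.ident_lt_pow _, h.ident_lt_pow _⟩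
  down v := by
    have hf' := isForest_propose hf hs
    refine length_bitCode_childMsg ?_ ?_ ?_ ?_
    · intro x hx
      obtain ⟨u, rfl⟩ := exists_target_eq hf hs hx
      exact h.ident_lt_pow u
    · intro x hx
      obtain ⟨u, -, rfl, -⟩ := plan_child hf hs hx
      exact h.ident_lt_pow u
    · have h1 := hf'.label_le_depth h (hc.mono (treeGraph_le_propose hf hs)) v
      rw [hs.next v] at h1
      change ((s v).plan (nbrMsgs N .propose s v) (C v) (r v)).dist + 1 ≤ _ at h1
      have h4 := h.height_lt
      have h5 := Suits.depth_le (q := q)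
      omega
    · have h1 := hf'.frag_lt h v
      rw [hs.next v] at h1
      exact h1

theorem kindShort_color (hs : KindTransition N q .color s s' C r)
    (hp : ∀ v, (s' v).color < 2 ^ b) : KindShort N q .color s C r (8 * (b + 1)) where
  up v := length_bitCode_parentMsg fun x y z hx => absurd hx (by simp [TreeParams.up])
  down v := by
    refine length_bitCode_childMsg (by simp) (by simp) ?_ (by positivity)
    have := hp v
    rw [hs.next v] at this
    exact this

theorem kindShort_orient [Finite V] (h : Suits N q m m' M b) (hh : IsHooked N s)
    (hp : ∀ v, (s v).color < q.palette) (hs : KindTransition N q .orient s s' C r) :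
    KindShort N q .orient s C r (8 * (b + 1)) where
  up v := by
    refine length_bitCode_parentMsg fun x y z hx => ?_
    simp only [TreeParams.up] at hx
    split_ifs at hx
    simp only [Option.some.injEq, Prod.mk.injEq] at hx
    obtain ⟨rfl, rfl, rfl⟩ := hx
    simp
  down v := by
    refine length_bitCode_childMsg (by simp) (by simp) ?_ (by positivity)
    have h1 := slotOf_le hh hs hp v
    have h2 := h.palette_le
    have h3 := h.height_lt
    unfold slotOf at h1
    omega

theorem kindShort_relabel [Finite V] (h : Suits N q m m' M b) (ho : IsOriented N s)
    (hs : KindTransition N q .relabel s s' C r) (hc : Compact N q.radius s') :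
    KindShort N q .relabel s C r (8 * (b + 1)) where
  up v := length_bitCode_parentMsg fun x y z hx => absurd hx (by simp [TreeParams.up])
  down v := by
    have hf := isForest_relabel ho hs
    have h1 := hf.label_le_depth h hc v
    have h2 := hf.frag_lt h v
    have h4 := h.height_lt
    have h5 := Suits.depth_le (q := q)
    refine length_bitCode_childMsg (by simp) (by simp) ?_ ?_
    · rw [hs.next v] at h1
      exact h1.trans_lt (by omega)
    · rw [hs.next v] at h2
      exact h2

theorem kindShort_flood : KindShort N q .flood s C r (8 * (b + 1)) where
  up v := length_bitCode_parentMsg fun x y z hx => absurd hx (by simp [TreeParams.up])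
  down v := length_bitCode_childMsg (by simp) (by simp) (by positivity) (by positivity)

theorem kindShort_grow : KindShort N q .grow s C r (8 * (b + 1)) where
  up v := length_bitCode_parentMsg fun x y z hx => absurd hx (by simp [TreeParams.up])
  down v := length_bitCode_childMsg (by simp) (by simp) (by positivity) (by positivity)

end Invariant

/-! ### Carrying the invariant through all stages -/

section Assembly

variable {V : Type} {N : ClusteredNetwork V} {q : TreeParams} {m m' M b : ℕ}
  {s s' : V → NodeData} {C : V → Set (ℕ × ParentMsg)} {r : V → Option ChildMsg}

/-- The invariant before stage `j`. -/
def StageInv (N : ClusteredNetwork V) (q : TreeParams) (m M j : ℕ) (s : V → NodeData) : Prop :=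
  if j < q.radius then FloodInv N j s
  else if j < 2 * q.radius then GrowInv N (j - q.radius) s
  else PhaseInv N q m M ((j - 2 * q.radius) / 4) (q.kind j) s

theorem phaseInv_of_growInv [Finite V] (h : Suits N q m m' M b) (hg : GrowInv N q.radius s) :
    PhaseInv N q m M 0 .propose s := by
  have hf := isForest_of_growInv hg h.walk
  refine ⟨compact_of_growInv hg hf, hf, ?_⟩
  have h1 := ncard_rootSet_le_of_growInv hg hf
  have h2 := h.classes_le
  rw [pow_zero, Nat.div_one]
  exact le_max_of_le_right (h1.trans h2)

theorem PhaseInv.propose [Finite V] (h : Suits N q m m' M b) {i : ℕ}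
    (hI : PhaseInv N q m M i .propose s) (hs : KindTransition N q .propose s s' C r) :
    PhaseInv N q m M i .color s' ∧ KindShort N q .propose s C r (8 * (b + 1)) := by
  obtain ⟨hc, hf, hr⟩ := hI
  exact ⟨⟨hc.mono (treeGraph_le_propose hf hs), isHooked_propose hf hs,
    (ncard_rootSet_propose_le hf hs).trans hr, allHooked_propose h.connected hf hs,
    color_propose_lt h hf hs⟩, kindShort_propose h hf hc hs⟩

theorem PhaseInv.color [Finite V] (h : Suits N q m m' M b) {i : ℕ}
    (hI : PhaseInv N q m M i .color s) (hs : KindTransition N q .color s s' C r) :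
    PhaseInv N q m M i .orient s' ∧ KindShort N q .color s C r (8 * (b + 1)) := by
  obtain ⟨hc, hh, hr, ha, hcol⟩ := hI
  have hpar : ∀ v, (s' v).parent = (s v).parent := fun v => by rw [hs.next v]; rfl
  have hroot : rootSet s' = rootSet s := by
    ext v
    simp [rootSet, hpar]
  have hp : ∀ v, (s' v).color < q.palette := by
    rw [h.palette_eq]
    exact color_lt hh hs h.bits_pos' fun v => (hcol v).trans_le h.le_pow
  refine ⟨⟨?_, isHooked_color hh hs, by rwa [hroot], ?_, hp⟩, kindShort_color hs ?_⟩
  · exact hc.mono (treeGraph_eq_of_parent_eq hpar).ge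
  · intro h2
    rw [hroot] at h2
    exact allHooked_color hh (ha h2) hs
  · intro v
    have h3 := h.height_lt
    have h4 := h.palette_le
    have h5 := hp v
    omega

theorem PhaseInv.orient [Finite V] (h : Suits N q m m' M b) {i : ℕ}
    (hI : PhaseInv N q m M i .orient s) (hs : KindTransition N q .orient s s' C r) :
    PhaseInv N q m M i .relabel s' ∧ KindShort N q .orient s C r (8 * (b + 1)) := by
  obtain ⟨hc, hh, hr, ha, hp⟩ := hI
  have hl := hh.forest.label_le_depth h hc
  refine ⟨⟨hc.mono (treeGraph_le_orient hs), isOriented_orient hh hs hp hl, ?_,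
    label_orient_le hh hs hp hl⟩, kindShort_orient h hh hp hs⟩
  have hle := Set.ncard_le_ncard (rootSet_orient_subset hs) (Set.toFinite _)
  by_cases h2 : 2 ≤ (rootSet s).ncard
  · have h3 := two_mul_ncard_rootSet_le hh (ha h2) hs
    refine le_max_of_le_right ?_
    rw [pow_succ, ← Nat.div_div_eq_div_mul, Nat.le_div_iff_mul_le (by norm_num)]
    -- With at least two roots the bound in force is `M / 2 ^ i`, not `1`, and it gets halved.
    rcases le_max_iff.1 hr with h4 | h4 <;> omega
  · exact le_max_of_le_left (by omega)

theorem PhaseInv.relabel [Finite V] (h : Suits N q m m' M b) {i : ℕ}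
    (hI : PhaseInv N q m M i .relabel s) (hs : KindTransition N q .relabel s s' C r) :
    PhaseInv N q m M (i + 1) .propose s' ∧ KindShort N q .relabel s C r (8 * (b + 1)) := by
  obtain ⟨hc, ho, hr, hl⟩ := hI
  have hpar : ∀ v, (s' v).parent = (s v).parent := fun v => by rw [hs.next v]; rfl
  have hroot : rootSet s' = rootSet s := by
    ext v
    simp [rootSet, hpar]
  have hc' : Compact N q.radius s' := hc.mono (treeGraph_eq_of_parent_eq hpar).ge
  exact ⟨⟨hc', isForest_relabel ho hs, by rwa [hroot]⟩, kindShort_relabel h ho hs hc'⟩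

theorem stageInv_succ [Finite V] (h : Suits N q m m' M b) {j : ℕ} (hI : StageInv N q m M j s)
    (hs : KindTransition N q (q.kind j) s s' C r) :
    StageInv N q m M (j + 1) s' ∧ KindShort N q (q.kind j) s C r (8 * (b + 1)) := by
  have hpos := h.radius_pos
  unfold StageInv at hI ⊢
  by_cases h1 : j < q.radius
  · have hk : q.kind j = .flood := by simp [TreeParams.kind, h1]
    rw [hk] at hs ⊢
    rw [if_pos h1] at hI
    have hI' := floodInv_flood hI hs
    refine ⟨?_, kindShort_flood⟩
    by_cases h2 : j + 1 < q.radius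
    · rwa [if_pos h2]
    · have e : j + 1 = q.radius := by omega
      rw [if_neg h2, if_pos (by omega), e, Nat.sub_self]
      rw [e] at hI'
      exact growInv_of_floodInv hI' h.walk
  rw [if_neg h1] at hI
  rw [if_neg (by omega)]
  by_cases h2 : j < 2 * q.radius
  · have hk : q.kind j = .grow := by simp [TreeParams.kind, h1, h2]
    rw [hk] at hs ⊢
    rw [if_pos h2] at hI
    have hI' := growInv_grow hI hs
    refine ⟨?_, kindShort_grow⟩
    by_cases h3 : j + 1 < 2 * q.radius
    · rw [if_pos h3]
      have e : j + 1 - q.radius = j - q.radius + 1 := by omega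
      rwa [e]
    · have e : j - q.radius + 1 = q.radius := by omega
      rw [e] at hI'
      have hk' : q.kind (j + 1) = .propose := by
        have e' : (j + 1 - 2 * q.radius) = 0 := by omega
        simp [TreeParams.kind, TreeParams.phaseKind, h3, e', show ¬ j + 1 < q.radius by omega]
      rw [if_neg h3, hk', show j + 1 - 2 * q.radius = 0 by omega, Nat.zero_div]
      exact phaseInv_of_growInv h hI'
  rw [if_neg h2] at hI
  rw [if_neg (by omega)]
  obtain ⟨i, rfl⟩ := Nat.exists_eq_add_of_le (not_lt.1 h2)
  rw [Nat.add_sub_cancel_left] at hI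
  rw [show 2 * q.radius + i + 1 - 2 * q.radius = i + 1 by omega]
  have hk : ∀ x, q.kind (2 * q.radius + x) = TreeParams.phaseKind (x % 4) := by
    intro x
    simp [TreeParams.kind, show ¬ 2 * q.radius + x < q.radius by omega]
  rw [add_assoc, hk (i + 1)]
  rw [hk] at hI hs ⊢
  obtain ⟨d, e | e | e | e⟩ : ∃ d, i = 4 * d ∨ i = 4 * d + 1 ∨ i = 4 * d + 2 ∨ i = 4 * d + 3 :=
    ⟨i / 4, by omega⟩
  · rw [show i % 4 = 0 by omega, show i / 4 = d by omega] at *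
    rw [show (i + 1) % 4 = 1 by omega, show (i + 1) / 4 = d by omega]
    exact hI.propose h hs
  · rw [show i % 4 = 1 by omega, show i / 4 = d by omega] at *
    rw [show (i + 1) % 4 = 2 by omega, show (i + 1) / 4 = d by omega]
    exact hI.color h hs
  · rw [show i % 4 = 2 by omega, show i / 4 = d by omega] at *
    rw [show (i + 1) % 4 = 3 by omega, show (i + 1) / 4 = d by omega]
    exact hI.orient h hs
  · rw [show i % 4 = 3 by omega, show i / 4 = d by omega] at *
    rw [show (i + 1) % 4 = 0 by omega, show (i + 1) / 4 = d + 1 by omega]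
    exact hI.relabel h hs

theorem StageInv.isOriented [Finite V] (h : Suits N q m m' M b) {j : ℕ}
    (hI : StageInv N q m M j s) :
    IsOriented N s ∧ ∀ v, (s v).label ≤ (2 * q.palette + 1) * q.depth := by
  have h1 := h.depth_pos
  have h2 := Suits.depth_le (q := q)
  unfold StageInv at hI
  split_ifs at hI with h3 h4
  · refine ⟨⟨hI.id, fun v => (hI.label v).ge, fun v i hi => ?_⟩, fun v => ?_⟩
    · rw [hI.parent v] at hi
      exact absurd hi (by simp)
    · rw [hI.label v]
      omega
  · refine ⟨⟨hI.id, fun v => ?_, fun v i hi => ?_⟩, fun v => ?_⟩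
    · rcases hp : (s v).parent with _ | i
      · exact (hI.root v hp).ge
      · obtain ⟨u, -, -, -, hl⟩ := hI.parent v i hp
        omega
    · obtain ⟨u, ha, hu, -, hl⟩ := hI.parent v i hi
      exact ⟨u, ha.1, hu, by omega⟩
    · have := hI.label v
      omega
  · obtain ⟨hc, hI⟩ := hI
    have key : IsForest N s →
        IsOriented N s ∧ ∀ v, (s v).label ≤ (2 * q.palette + 1) * q.depth := fun hf =>
      ⟨hf.isOriented, fun v => (hf.label_le_depth h hc v).trans h2⟩
    cases hk : q.kind j <;> rw [hk] at hI
    · exact hI.elim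
    · exact hI.elim
    · exact key hI.1
    · exact key hI.1.forest
    · exact key hI.1.forest
    · exact ⟨hI.1, hI.2.2⟩

theorem StageInv.short [Finite V] (h : Suits N q m m' M b) {j : ℕ}
    (hI : StageInv N q m M j s) (v : V) :
    (bitCode ((s v).label, TreeParams.exch (q.kind j) (s v))).length ≤ 8 * (b + 1) := by
  obtain ⟨ho, hl⟩ := hI.isOriented h
  have hl : (s v).label < 2 ^ b := (hl v).trans_lt h.height_lt
  have hone : 1 < 2 ^ b :=
    Nat.one_lt_two_pow (by have := h.bits_pos; have := h.le_bits; omega)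
  unfold StageInv at hI
  split_ifs at hI with h3 h4
  · have hk : q.kind j = .flood := by simp [TreeParams.kind, h3]
    rw [hk]
    obtain ⟨u, -, hu⟩ := hI.frag v
    exact length_bitCode_nbrMsg hl (hu ▸ h.ident_lt_pow u) (by simp)
  · have hk : q.kind j = .grow := by simp [TreeParams.kind, h3, h4]
    rw [hk]
    refine length_bitCode_nbrMsg hl ?_ (by simp)
    split_ifs
    · exact hone
    · positivity
  · obtain ⟨hc, hI⟩ := hI
    cases hk : q.kind j <;> rw [hk] at hI
    · exact hI.elim
    · exact hI.elim
    · refine length_bitCode_nbrMsg hl (hI.1.frag_lt h v) fun x hx => ?_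
      obtain ⟨u, -, rfl, -⟩ := ho.parent v x hx
      exact h.ident_lt_pow u
    · exact length_bitCode_nbrMsg hl ((hI.2.2.2 v).trans_le h.two_mul_lt) (by simp)
    · have h5 := hI.2.2.2 v
      have h6 := h.palette_le
      have h7 := h.height_lt
      refine length_bitCode_nbrMsg hl (by omega) fun x hx => ?_
      obtain ⟨-, u, -, rfl⟩ := hI.1.hook v x hx
      exact h.ident_lt_pow u
    · exact length_bitCode_nbrMsg hl (by positivity) (by simp)

end Assembly

/-! ### The spanning tree at the end -/

section Correctness

variable {V : Type} {N : ClusteredNetwork V} {q : TreeParams} {m m' M b : ℕ}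
  {s s' : V → NodeData}

/-- A forest with at most one root is a tree. -/
theorem IsForest.isTree [Finite V] [Nonempty V] (hf : IsForest N s)
    (hr : (rootSet s).ncard ≤ 1) : (treeGraph N s).IsTree := by
  have hroot : ∀ v u, (s v).parent = none → (s u).parent = none → v = u := fun v u hv hu =>
    (Set.ncard_le_one_iff (Set.toFinite _)).1 hr hv hu
  have hconn : (treeGraph N s).Connected := by
    refine ⟨fun v u => ?_⟩
    obtain ⟨x, h1, -, w, -⟩ := hf.exists_walk_root v
    obtain ⟨y, h2, -, w', -⟩ := hf.exists_walk_root u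
    have := hroot x y h1 h2
    subst this
    exact ⟨w.append w'.reverse⟩
  obtain ⟨x, hx, -⟩ := hf.exists_walk_root (Classical.arbitrary V)
  refine SimpleGraph.isTree_iff_connected_and_card.2 ⟨hconn, ?_⟩
  have h1 := hconn.card_vert_le_card_edgeSet_add_one
  refine le_antisymm ?_ h1
  have hpar : ∀ v, ∃ u, v ≠ x → IsParent N s v u := by
    intro v
    rcases hp : (s v).parent with _ | i
    · exact ⟨v, fun h => absurd (hroot v x hp hx) h⟩
    · obtain ⟨u, hu, -⟩ := hf.isParent_of_some hp
      exact ⟨u, fun _ => hu⟩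
  choose f hfp using hpar
  have hne : ∀ {v u}, IsParent N s v u → v ≠ x := by
    rintro v u h rfl
    exact absurd (h.2.symm.trans hx) (by simp)
  -- Every edge joins some node other than the root `x` to its parent, so there are fewer edges than
  -- nodes; connectedness gives the other inequality.
  have hsub : (treeGraph N s).edgeSet ⊆ (fun v => s(v, f v)) '' {v | v ≠ x} := by
    intro e
    induction e with
    | _ v u =>
      rintro (h | h)
      · exact ⟨v, hne h, congrArg (fun z => s(v, z)) ((hfp v (hne h)).unique h)⟩
      · exact ⟨u, hne h, (congrArg (fun z => s(u, z)) ((hfp u (hne h)).unique h)).trans Sym2.eq_swap⟩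
  have h2 := (Set.ncard_le_ncard hsub (Set.toFinite _)).trans
    (Set.ncard_image_le (Set.toFinite _))
  have h3 := Set.ncard_add_ncard_compl ({x} : Set V)
  rw [Set.ncard_singleton] at h3
  have h4 : ({x}ᶜ : Set V) = {v | v ≠ x} := rfl
  rw [h4] at h3
  rw [Nat.card_coe_set_eq]
  omega

theorem IsForest.diam_le [Finite V] [Nonempty V] (hf : IsForest N s)
    (hr : (rootSet s).ncard ≤ 1) {L : ℕ} (hL : ∀ v, (s v).label ≤ L) :
    (treeGraph N s).diam ≤ 2 * L := by
  obtain ⟨v, u, h⟩ := (treeGraph N s).exists_dist_eq_diam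
  rw [← h]
  have hfrag : (s v).frag = (s u).frag := by
    obtain ⟨x, h1, h2, -⟩ := hf.exists_walk_root v
    obtain ⟨y, h3, h4, -⟩ := hf.exists_walk_root u
    rw [h2, h4, (Set.ncard_le_one_iff (Set.toFinite _)).1 hr h1 h3]
  obtain ⟨w, hw⟩ := hf.exists_walk (L := L) (fun v => (hL v).trans (Nat.le_succ L)) hfrag
  exact (SimpleGraph.dist_le w).trans hw

/-- The protocol computes a spanning tree if its parameters suit the network. -/
theorem treeProtocol_correct [Finite V] (p : ℕ → TreeParams) {n : ℕ}
    (h : Suits N (p n) m m' M b) :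
    (treeProtocol p).toAlgorithm.MessagesBoundedBy N n (8 * (b + 1) : ℕ) ∧
    ∃ R, R = (2 * (p n).radius + 4 * (p n).phases) *
        (2 * ((2 * (p n).palette + 1) * (p n).depth) + 3) + 1 ∧
      (∀ v, (treeProtocol p).toAlgorithm.TerminatesWithin N n R v) ∧
      (∀ v, (treeProtocol p).toAlgorithm.awakeRounds N n R v ≤
        5 * (2 * (p n).radius + 4 * (p n).phases) + 1) ∧
      ∃ T : SimpleGraph V, T ≤ N.graph ∧ T.IsTree ∧ T.diam ≤ 2 * (p n).depth ∧
        (treeProtocol p).toAlgorithm.Outputs N n R T := by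
  have hpos := h.radius_pos
  have : Nonempty V := h.connected.nonempty
  obtain ⟨hM, s, hI, hR⟩ := StagedProtocol.execution (P := treeProtocol p) (N := N) (n := n)
    (B := (8 * (b + 1) : ℕ)) (StageInv N (p n) m M) (by
      unfold StageInv
      rw [if_pos (by omega)]
      exact
        { id := fun _ => rfl
          mates := fun _ => rfl
          parent := fun _ => rfl
          label := fun _ => rfl
          frag := fun v => ⟨v, N.cluster.refl' v, rfl⟩
          le := fun v u w hw => by
            rw [SimpleGraph.Walk.eq_of_length_eq_zero (Nat.le_zero.1 hw)]
            exact le_rfl })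
    (fun j s _ hI => by
      obtain ⟨h1, h2⟩ := hI.isOriented h
      exact ⟨h1.pos, h2, h1.parent⟩)
    (fun j s _ hI v => by exact_mod_cast hI.short h v)
    (fun j s s' C r _ hI hT => by
      obtain ⟨h1, h2⟩ := stageInv_succ h hI (kindTransition_of_transition hT)
      exact ⟨h1, fun v => by exact_mod_cast h2.up v, fun v => by exact_mod_cast h2.down v⟩)
  have hst : (treeProtocol p).stages n = 2 * (p n).radius + 4 * (p n).phases := rfl
  -- The concluding exchange is that of a `propose` stage, in which nodes announce their parents.
  -- This is how a node learns who its children are.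
  have hkind : (p n).kind ((treeProtocol p).stages n) = .propose := by
    rw [hst, TreeParams.kind, if_neg (by omega), if_neg (by omega), Nat.add_sub_cancel_left,
      Nat.mul_mod_right]
    rfl
  have hI' := hI
  unfold StageInv at hI'
  rw [hkind, hst, if_neg (by omega), if_neg (by omega), Nat.add_sub_cancel_left,
    Nat.mul_div_cancel_left _ (by norm_num)] at hI'
  obtain ⟨hc, hf, hr⟩ := hI'
  -- The quotient is `0` after the last phase, so the maximum with `1` leaves a single root.
  rw [Nat.div_eq_of_lt h.lt_pow_phases] at hr
  have hr : (rootSet s).ncard ≤ 1 := by simpa using hr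
  refine ⟨hM, _, rfl, fun v => (hR v).1, fun v => (hR v).2.1, treeGraph N s, treeGraph_le,
    hf.isTree hr, hf.diam_le hr (hf.label_le_depth h hc), fun v => ?_⟩
  refine (hR v).2.2.trans ?_
  have hX : ∀ i l x y, (i, l, x, y) ∈ (treeProtocol p).nbrMsgsOf N n ((treeProtocol p).stages n) s v
      ↔ ∃ u, N.graph.Adj v u ∧ i = N.ident u ∧ l = (s u).label ∧ x = (s u).frag ∧
        y = (s u).parent := by
    intro i l x y
    change (∃ u, N.graph.Adj v u ∧ (i, l, x, y) = (N.ident u, (s u).label,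
      TreeParams.exch ((p n).kind ((treeProtocol p).stages n)) (s u))) ↔ _
    simp only [hkind, TreeParams.exch, Prod.mk.injEq]
  change {i | (s v).parent = some i ∨ ∃ l x, (i, l, x, some (s v).id) ∈
    (treeProtocol p).nbrMsgsOf N n ((treeProtocol p).stages n) s v} = _
  ext i
  simp only [hX, Set.mem_ofPred_eq, hf.id v]
  constructor
  · rintro (hi | ⟨l, x, u, h1, rfl, -, -, h2⟩)
    · obtain ⟨u, hu, rfl⟩ := hf.isParent_of_some hi
      exact ⟨u, Or.inl hu, rfl⟩
    · exact ⟨u, Or.inr ⟨h1.symm, h2.symm⟩, rfl⟩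
  · rintro ⟨u, h1 | h1, rfl⟩
    · exact Or.inl h1.2
    · exact Or.inr ⟨_, _, u, h1.1.symm, rfl, rfl, rfl, h1.2.symm⟩

end Correctness

/-! ### Choice of the parameters -/

section Parameters

theorem Nat.size_mul_le (x y : ℕ) : (x * y).size ≤ x.size + y.size := by
  rw [Nat.size_le, pow_add]
  exact Nat.mul_lt_mul'' (Nat.lt_size_self x) (Nat.lt_size_self y)

theorem Nat.size_le_self (x : ℕ) : x.size ≤ x :=
  Nat.size_le.2 Nat.lt_two_pow_self

theorem Nat.log_le_size (x : ℕ) : Real.log x ≤ x.size := by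
  rcases Nat.eq_zero_or_pos x with rfl | hx
  · simp
  · have h1 : (x : ℝ) ≤ 2 ^ x.size := by exact_mod_cast (Nat.lt_size_self x).le
    have h2 := Real.log_le_log (by exact_mod_cast hx) h1
    rw [Real.log_pow] at h2
    have h3 := Real.log_two_lt_d9
    have h4 : (0 : ℝ) ≤ x.size := Nat.cast_nonneg _
    nlinarith

theorem Nat.size_le_log {x : ℕ} (hx : 1 ≤ x) : (x.size : ℝ) ≤ 2 * Real.log x + 1 := by
  have h0 : 0 < x.size := Nat.size_pos.2 hx
  have h1 : (2 : ℝ) ^ (x.size - 1) ≤ x := by exact_mod_cast Nat.lt_size.1 (by omega)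
  have h2 := Real.log_le_log (by positivity) h1
  rw [Real.log_pow, Nat.cast_sub h0, Nat.cast_one] at h2
  have h3 := Real.log_two_gt_d9
  have h4 : (1 : ℝ) ≤ x.size := by exact_mod_cast h0
  nlinarith

theorem one_lt_log_three : 1 < Real.log 3 := by
  rw [Real.lt_log_iff_exp_lt (by norm_num)]
  exact Real.exp_one_lt_d9.trans (by norm_num)

theorem log_three_le {n : ℕ} (hn : 3 ≤ n) : Real.log 3 ≤ Real.log n :=
  Real.log_le_log (by norm_num) (by exact_mod_cast hn)

theorem loglog_three_pos : 0 < Real.log (Real.log 3) :=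
  Real.log_pos one_lt_log_three

theorem loglog_three_le {n : ℕ} (hn : 3 ≤ n) : Real.log (Real.log 3) ≤ Real.log (Real.log n) :=
  Real.log_le_log (by linarith [one_lt_log_three]) (log_three_le hn)

theorem size_le_mul_log {n : ℕ} (hn : 3 ≤ n) : (n.size : ℝ) ≤ 3 * Real.log n := by
  have h1 := Nat.size_le_log (x := n) (by omega)
  have h2 := log_three_le hn
  have h3 := one_lt_log_three
  linarith

theorem loglog_le_size_size {n : ℕ} (hn : 3 ≤ n) : Real.log (Real.log n) ≤ n.size.size := by
  have h2 := log_three_le hn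
  have h3 := one_lt_log_three
  exact (Real.log_le_log (by linarith) (Nat.log_le_size n)).trans (Nat.log_le_size _)

/-- From `n.size ≤ 3 * log n` and `log 3 ≤ 2` one gets the bound `2 * log (log n) + 5`. Since `log
(log n) ≥ log (log 3) > 0`, the `5` is absorbed into the factor. -/
theorem size_size_le_mul_loglog {n : ℕ} (hn : 3 ≤ n) :
    (n.size.size : ℝ) ≤ (5 / Real.log (Real.log 3) + 2) * Real.log (Real.log n) := by
  have h0 : 1 ≤ n.size := Nat.size_pos.2 (by omega)
  have h1 := Nat.size_le_log h0
  have h2 := log_three_le hn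
  have h3 := one_lt_log_three
  have h4 := Real.log_le_log (by exact_mod_cast h0) (size_le_mul_log hn)
  rw [Real.log_mul (by norm_num) (by linarith)] at h4
  have h5 : Real.log 3 ≤ 2 := by
    have := Real.log_le_sub_one_of_pos (x := 3) (by norm_num)
    linarith
  have h6 := loglog_three_pos
  have h7 := loglog_three_le hn
  have h8 : 5 ≤ 5 / Real.log (Real.log 3) * Real.log (Real.log n) := by
    rw [div_mul_eq_mul_div, le_div_iff₀ h6]
    linarith
  rw [add_mul]
  linarith

/-- The parameters for the global parameter `n`. -/
noncomputable def treeParams (b : ℕ) (C₁ C₂ : ℝ) (n : ℕ) : TreeParams where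
  radius := (⌈C₂⌉₊ + 1) * n.size.size
  depth := ⌊C₁ * (Real.log n / Real.log (Real.log n))⌋₊ * (2 * ((⌈C₂⌉₊ + 1) * n.size.size) + 1)
  -- Identifiers have `m = b * n.size + 1` bits, the first colours are below `2 * m`, and the second
  -- ones below twice the number of bits of `2 * m`.
  palette := 2 * (2 * (b * n.size + 1)).size
  phases := (⌊C₁ * (Real.log n / Real.log (Real.log n))⌋₊).size

variable (b : ℕ) (C₁ C₂ : ℝ) {n : ℕ}

theorem one_le_size_size (hn : 3 ≤ n) : 1 ≤ n.size.size :=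
  Nat.size_pos.2 (Nat.size_pos.2 (by omega))

theorem suits_treeParams (hn : 3 ≤ n) {V : Type} [Finite V] (N : ClusteredNetwork V)
    (hG : N.graph.Connected) (hid : ∀ v, N.ident v < n ^ b)
    (hC : (N.cluster.classes.ncard : ℝ) ≤ C₁ * (Real.log n / Real.log (Real.log n)))
    (hD : ∀ C ∈ N.cluster.classes, (N.graph.induce C).Connected ∧
      ((N.graph.induce C).diam : ℝ) ≤ C₂ * Real.log (Real.log n)) :
    Suits N (treeParams b C₁ C₂ n) (b * n.size + 1) (2 * (b * n.size + 1)).size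
      ⌊C₁ * (Real.log n / Real.log (Real.log n))⌋₊
      (b * n.size + 1 + (2 * (treeParams b C₁ C₂ n).palette + 1) +
        (treeParams b C₁ C₂ n).depth) where
  connected := hG
  radius_pos := Nat.mul_pos (by omega) (one_le_size_size hn)
  walk v u hvu := by
    refine N.exists_clusterGraph_walk (fun C hC => ⟨(hD C hC).1, ?_⟩) hvu
    have h1 := (hD C hC).2
    have h2 := loglog_le_size_size hn
    have h3 := loglog_three_le hn
    have h4 := loglog_three_pos
    have h5 : C₂ ≤ ((⌈C₂⌉₊ + 1 : ℕ) : ℝ) := by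
      push_cast
      linarith [Nat.le_ceil C₂]
    have h6 : ((N.graph.induce C).diam : ℝ) ≤ ((⌈C₂⌉₊ + 1 : ℕ) : ℝ) * (n.size.size : ℝ) :=
      h1.trans (mul_le_mul h5 h2 (by linarith) (Nat.cast_nonneg _))
    exact_mod_cast h6
  bits_pos := by omega
  ident_lt v := by
    have h1 : n ^ b ≤ (2 ^ n.size) ^ b := Nat.pow_le_pow_left (Nat.lt_size_self n).le b
    rw [← pow_mul, mul_comm] at h1
    exact ((hid v).trans_le h1).trans_le (Nat.pow_le_pow_right (by norm_num) (by omega))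
  classes_le := Nat.le_floor hC
  depth_eq := rfl
  le_pow := (Nat.lt_size_self _).le
  palette_eq := rfl
  lt_pow_phases := Nat.lt_size_self _
  le_bits := by omega
  -- The crude `x < 2 ^ x` for both factors is enough, because palette and depth are themselves
  -- `O(log n)`.
  height_lt := by
    calc (2 * (treeParams b C₁ C₂ n).palette + 1) * (treeParams b C₁ C₂ n).depth
        < 2 ^ (2 * (treeParams b C₁ C₂ n).palette + 1) * 2 ^ (treeParams b C₁ C₂ n).depth :=
          Nat.mul_lt_mul'' Nat.lt_two_pow_self Nat.lt_two_pow_self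
      _ = 2 ^ (2 * (treeParams b C₁ C₂ n).palette + 1 + (treeParams b C₁ C₂ n).depth) :=
          (pow_add _ _ _).symm
      _ ≤ _ := Nat.pow_le_pow_right (by norm_num) (by omega)

/-- Bounds for the parameters in terms of `log n` and `log (log n)`. -/
theorem exists_bounds : ∃ c : ℝ, 1 ≤ c ∧ ∀ n : ℕ, 3 ≤ n →
    1 ≤ Real.log n ∧ 1 ≤ c * Real.log (Real.log n) ∧
    (n.size : ℝ) ≤ c * Real.log n ∧
    ((treeParams b C₁ C₂ n).radius : ℝ) ≤ c * Real.log (Real.log n) ∧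
    ((treeParams b C₁ C₂ n).phases : ℝ) ≤ c * Real.log (Real.log n) ∧
    ((treeParams b C₁ C₂ n).palette : ℝ) ≤ c * Real.log (Real.log n) ∧
    ((treeParams b C₁ C₂ n).palette : ℝ) ≤ c * Real.log n ∧
    ((treeParams b C₁ C₂ n).depth : ℝ) ≤ c * Real.log n := by
  set y₀ := Real.log (Real.log 3) with hy₀
  have hy₀pos : 0 < y₀ := loglog_three_pos
  set e := 5 / y₀ + 2 with he
  have hepos : 2 ≤ e := by
    have : 0 ≤ 5 / y₀ := by positivity
    linarith
  set F : ℕ := ⌈|C₁| / y₀⌉₊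
  set c₁ : ℝ := (⌈C₂⌉₊ + 1 : ℕ) * e with hc₁
  set c₂ : ℝ := (F.size + 1 : ℕ) * e with hc₂
  set c₃ : ℝ := (2 * ((2 * b + 2).size + 1) : ℕ) * e with hc₃
  set c₄ : ℝ := (2 * ((2 * b + 2).size + 1) : ℕ) * 3 with hc₄
  set c₅ : ℝ := |C₁| * ((2 * (⌈C₂⌉₊ + 1) + 1 : ℕ) * e) with hc₅
  have p₁ : 0 ≤ c₁ := by positivity
  have p₂ : 0 ≤ c₂ := by positivity
  have p₃ : 0 ≤ c₃ := by positivity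
  have p₄ : 0 ≤ c₄ := by positivity
  have p₅ : 0 ≤ c₅ := by positivity
  refine ⟨3 + e + c₁ + c₂ + c₃ + c₄ + c₅, by linarith, fun n hn => ?_⟩
  have hx : 1 ≤ Real.log n := by linarith [one_lt_log_three, log_three_le hn]
  have hy : y₀ ≤ Real.log (Real.log n) := loglog_three_le hn
  have hl := size_le_mul_log hn
  have hll : (n.size.size : ℝ) ≤ e * Real.log (Real.log n) := size_size_le_mul_loglog hn
  have hl1 : (1 : ℝ) ≤ n.size.size := by exact_mod_cast one_le_size_size hn
  have hle := Nat.log_le_size n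
  set x := Real.log n
  set y := Real.log x
  have hy0 : 0 < y := hy₀pos.trans_le hy
  have mono_x : ∀ {d : ℝ}, d ≤ 3 + e + c₁ + c₂ + c₃ + c₄ + c₅ →
      d * x ≤ (3 + e + c₁ + c₂ + c₃ + c₄ + c₅) * x := fun h =>
    mul_le_mul_of_nonneg_right h (by linarith)
  have mono_y : ∀ {d : ℝ}, d ≤ 3 + e + c₁ + c₂ + c₃ + c₄ + c₅ →
      d * y ≤ (3 + e + c₁ + c₂ + c₃ + c₄ + c₅) * y := fun h =>
    mul_le_mul_of_nonneg_right h hy0.le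
  -- The absolute value covers negative `C₁`, for which the natural floor is `0`.
  have hM : (⌊C₁ * (x / y)⌋₊ : ℝ) ≤ |C₁| * (x / y) := by
    have h1 : C₁ * (x / y) ≤ |C₁| * (x / y) :=
      mul_le_mul_of_nonneg_right (le_abs_self _) (by positivity)
    calc (⌊C₁ * (x / y)⌋₊ : ℝ) ≤ ⌊|C₁| * (x / y)⌋₊ := by exact_mod_cast Nat.floor_mono h1
      _ ≤ |C₁| * (x / y) := Nat.floor_le (by positivity)
  have hpal : (treeParams b C₁ C₂ n).palette ≤ 2 * ((2 * b + 2).size + 1) * n.size.size := by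
    have h1 : 2 * (b * n.size + 1) ≤ (2 * b + 2) * n.size := by
      have : 1 ≤ n.size := Nat.size_pos.2 (by omega)
      nlinarith
    have h2 := (Nat.size_le_size h1).trans (Nat.size_mul_le _ _)
    have h3 : 1 ≤ n.size.size := one_le_size_size hn
    change 2 * (2 * (b * n.size + 1)).size ≤ _
    nlinarith
  have hpal' : ((treeParams b C₁ C₂ n).palette : ℝ) ≤
      (2 * ((2 * b + 2).size + 1) : ℕ) * (n.size.size : ℝ) := by exact_mod_cast hpal
  refine ⟨hx, ?_, hl.trans (mono_x (by linarith)), ?_, ?_, ?_, ?_, ?_⟩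
  · exact (hl1.trans hll).trans (mono_y (by linarith))
  · have h1 : ((treeParams b C₁ C₂ n).radius : ℝ) = (⌈C₂⌉₊ + 1 : ℕ) * (n.size.size : ℝ) := by
      exact_mod_cast rfl
    rw [h1]
    refine (mul_le_mul_of_nonneg_left hll (Nat.cast_nonneg _)).trans ?_
    rw [← mul_assoc]
    exact mono_y (by linarith)
  -- Only the number of bits of the cluster bound matters for the phases, so `x / y` may be replaced
  -- by the larger `x / y₀`.
  · have h1 : ⌊C₁ * (x / y)⌋₊ ≤ F * n.size := by
      have h2 : |C₁| * (x / y) ≤ |C₁| / y₀ * x := by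
        rw [div_mul_eq_mul_div, mul_div_assoc]
        exact mul_le_mul_of_nonneg_left
          (div_le_div_of_nonneg_left (by linarith) hy₀pos hy) (abs_nonneg _)
      have h3 : |C₁| / y₀ * x ≤ F * (n.size : ℝ) :=
        mul_le_mul (Nat.le_ceil _) hle (by linarith) (Nat.cast_nonneg _)
      exact_mod_cast hM.trans (h2.trans h3)
    have h2 := (Nat.size_le_size h1).trans (Nat.size_mul_le _ _)
    have h3 : (treeParams b C₁ C₂ n).phases ≤ (F.size + 1) * n.size.size := by
      have h4 : 1 ≤ n.size.size := one_le_size_size hn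
      change (⌊C₁ * (x / y)⌋₊).size ≤ _
      nlinarith
    have h4 : ((treeParams b C₁ C₂ n).phases : ℝ) ≤ (F.size + 1 : ℕ) * (n.size.size : ℝ) := by
      exact_mod_cast h3
    refine h4.trans ((mul_le_mul_of_nonneg_left hll (Nat.cast_nonneg _)).trans ?_)
    rw [← mul_assoc]
    exact mono_y (by linarith)
  · refine hpal'.trans ((mul_le_mul_of_nonneg_left hll (Nat.cast_nonneg _)).trans ?_)
    rw [← mul_assoc]
    exact mono_y (by linarith)
  · have h1 : (n.size.size : ℝ) ≤ 3 * x :=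
      le_trans (by exact_mod_cast Nat.size_le_self _) hl
    refine hpal'.trans ((mul_le_mul_of_nonneg_left h1 (Nat.cast_nonneg _)).trans ?_)
    rw [← mul_assoc]
    exact mono_x (by linarith)
  · have h1 : ((treeParams b C₁ C₂ n).depth : ℝ) =
        ⌊C₁ * (x / y)⌋₊ * (2 * ((⌈C₂⌉₊ + 1) * n.size.size) + 1 : ℕ) := by
      exact_mod_cast rfl
    have h2 : ((2 * ((⌈C₂⌉₊ + 1) * n.size.size) + 1 : ℕ) : ℝ) ≤
        (2 * (⌈C₂⌉₊ + 1) + 1 : ℕ) * (n.size.size : ℝ) := by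
      have h4 : 1 ≤ n.size.size := one_le_size_size hn
      exact_mod_cast (by nlinarith)
    have h3 := h2.trans (mul_le_mul_of_nonneg_left hll (Nat.cast_nonneg _))
    rw [h1]
    refine (mul_le_mul hM h3 (Nat.cast_nonneg _) (by positivity)).trans ?_
    -- The factor `log log n` of the radius cancels against the denominator in the number of
    -- clusters.
    have h4 : |C₁| * (x / y) * ((2 * (⌈C₂⌉₊ + 1) + 1 : ℕ) * (e * y)) = c₅ * x := by
      rw [hc₅]
      field_simp
    rw [h4]
    exact mono_x (by linarith)

end Parameters

/-! ### Collecting the constants -/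

theorem mainTheorem6 (a b : ℕ) (C₀ C₁ C₂ : ℝ) :
    ∃ (A : SleepingAlgorithm) (K : ℝ), ∀ n : ℕ, 3 ≤ n →
      ∀ (V : Type) [Finite V] (N : ClusteredNetwork V),
        N.graph.Connected →
        (∀ v, N.ident v < n ^ b) →
        (Nat.card V : ℝ) ≤ C₀ * Real.log n ^ a →
        (N.cluster.classes.ncard : ℝ) ≤ C₁ * (Real.log n / Real.log (Real.log n)) →
        (∀ C ∈ N.cluster.classes, (N.graph.induce C).Connected ∧
          ((N.graph.induce C).diam : ℝ) ≤ C₂ * Real.log (Real.log n)) →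
        A.MessagesBoundedBy N n (K * Real.log n) ∧
        ∃ R : ℕ, (R : ℝ) ≤ K * (Real.log n * Real.log (Real.log n) ^ 2) ∧
          (∀ v, A.TerminatesWithin N n R v) ∧
          (∀ v, (A.awakeRounds N n R v : ℝ) ≤ K * Real.log (Real.log n)) ∧
          ∃ T : SimpleGraph V, T ≤ N.graph ∧ T.IsTree ∧ (T.diam : ℝ) ≤ K * Real.log n ∧
            A.Outputs N n R T := by
  obtain ⟨c, hc1, hc⟩ := exists_bounds b C₁ C₂
  -- `k₁` is for message lengths, `k₂` for rounds, `k₃` for awake rounds and the diameter. There are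
  -- at most `6 * c * log (log n)` stages of five awake rounds, and the one extra round is absorbed
  -- by `1 ≤ c * log (log n)`, whence `31`.
  set k₁ : ℝ := 8 * (b * c + 2 * c + c + 3) with hk₁
  set k₂ : ℝ := 6 * c * (2 * (2 * c + c) * c + 3 * c) + c ^ 2 with hk₂
  set k₃ : ℝ := 31 * c with hk₃
  have hk₁0 : 0 ≤ k₁ := by positivity
  have hk₂0 : 0 ≤ k₂ := by positivity
  have hk₃0 : 0 ≤ k₃ := by positivity
  refine ⟨(treeProtocol (treeParams b C₁ C₂)).toAlgorithm, k₁ + k₂ + k₃, ?_⟩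
  intro n hn V _ N hG hid _ hC hD
  obtain ⟨h1, ⟨R, hR, hterm, hawake, T, hT, htree, hdiam, hout⟩⟩ :=
    treeProtocol_correct (treeParams b C₁ C₂) (suits_treeParams b C₁ C₂ hn N hG hid hC hD)
  obtain ⟨hx, hy, hl, hr, hf, hp, hp', hd⟩ := hc n hn
  have hy0 : 0 < Real.log (Real.log n) := loglog_three_pos.trans_le (loglog_three_le hn)
  set x := Real.log n
  set y := Real.log x
  set q := treeParams b C₁ C₂ n
  have hmsg : ((8 * (b * n.size + 1 + (2 * q.palette + 1) + q.depth + 1) : ℕ) : ℝ) ≤ k₁ * x := by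
    push_cast
    have : (b : ℝ) * n.size ≤ b * (c * x) := mul_le_mul_of_nonneg_left hl (Nat.cast_nonneg _)
    rw [hk₁]
    linarith
  refine ⟨fun t v u h2 h3 m h4 => (h1 t v u h2 h3 m h4).trans (hmsg.trans ?_), R, ?_, hterm,
    fun v => ?_, T, hT, htree, ?_, hout⟩
  · exact mul_le_mul_of_nonneg_right (by linarith) (by linarith)
  · have hlen : (R : ℝ) ≤ k₂ * (x * y ^ 2) := by
      rw [hR]
      push_cast
      have e1 : 2 * (q.radius : ℝ) + 4 * q.phases ≤ 6 * c * y := by linarith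
      have e2 : 2 * (q.palette : ℝ) + 1 ≤ (2 * c + c) * y := by linarith
      have e3 : (2 * (q.palette : ℝ) + 1) * q.depth ≤ (2 * c + c) * y * (c * x) :=
        mul_le_mul e2 hd (Nat.cast_nonneg _) (by positivity)
      have e4 : (1 : ℝ) ≤ c * y * x := by
        calc (1 : ℝ) = 1 * 1 := by norm_num
          _ ≤ c * y * x := mul_le_mul hy hx (by norm_num) (by positivity)
      have e5 : 2 * ((2 * (q.palette : ℝ) + 1) * q.depth) + 3 ≤
          (2 * (2 * c + c) * c + 3 * c) * (x * y) := by linarith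
      have e6 : (1 : ℝ) ≤ c ^ 2 * (x * y ^ 2) := by
        calc (1 : ℝ) = 1 * 1 := by norm_num
          _ ≤ c * y * (c * y * x) := mul_le_mul hy e4 (by norm_num) (by positivity)
          _ = _ := by ring
      have e7 := mul_le_mul e1 e5 (by positivity) (by positivity)
      calc _ ≤ 6 * c * y * ((2 * (2 * c + c) * c + 3 * c) * (x * y)) + c ^ 2 * (x * y ^ 2) :=
            add_le_add e7 e6
        _ = _ := by rw [hk₂]; ring
    exact hlen.trans (mul_le_mul_of_nonneg_right (by linarith) (by positivity))
  · have h2 : ((treeProtocol (treeParams b C₁ C₂)).toAlgorithm.awakeRounds N n R v : ℝ) ≤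
        5 * (2 * q.radius + 4 * q.phases) + 1 := by exact_mod_cast hawake v
    have h3 : k₃ * y ≤ (k₁ + k₂ + k₃) * y := mul_le_mul_of_nonneg_right (by linarith) hy0.le
    rw [hk₃] at h3
    linarith
  · have h2 : (T.diam : ℝ) ≤ 2 * q.depth := by exact_mod_cast hdiam
    have h3 : k₃ * x ≤ (k₁ + k₂ + k₃) * x := mul_le_mul_of_nonneg_right (by linarith) (by linarith)
    have h4 : 0 ≤ c * x := by positivity
    rw [hk₃] at h3
    linarith
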